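/- Let $\alpha\ge 0$ and let $\mu$ be a probability measure on $\mathbb{C}$ that is radially symmetric (invariant under all rotations about $0$), is supported on the closed unit disk, and has the following property: there are $\varepsilon\in(0,1]$ and constants $c_\mu,C_\mu>0$ such that on the annulus $\{z: 1-\varepsilon\le|z|\le 1\}$ the measure $\mu$ has a density $f_\mu$ with respect to Lebesgue measure, and $$c_\mu\le\frac{2\pi r f_\mu(re^{i\theta})}{(1-r)^\alpha}\le C_\mu\qquad\text{for all } 1-\varepsilon\le r<1,\ r>0,\ \theta\in\mathbb{R}.$$ Let $X_1,X_2,\dots$ be i.i.d. random variables with distribution $\mu$, let $\delta\in\left(\frac1{4\alpha+3},\frac1{\alpha+1}\right)$, and let $(c_n)$ be a sequence of positive numbers with $c_n\to\infty$ and $\log c_n=o(\log n)$. Put $$p_n(z)=\prod_{j=1}^n(z-X_j),\qquad \mathcal{A}_n=\{z\in\mathbb{C}:1-n^{-\delta}\le|z|\le1\}.$$ Then there are a constant $C>0$ and a deterministic real sequence $\eta_n\to0$ such that, with probability $1-O(1/c_n)$ as $n\to\infty$, the following three statements hold simultaneously. 1. $p_n$ has at least $\dfrac{n^{1-\delta(\alpha+1)}}{c_n\log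 n}$ distinct critical points in $\mathcal{A}_n$. 2. For each $i\in\{1,\dots,n\}$ with $X_i\in\mathcal{A}_n$, there is precisely one critical point $W_i^{(n)}$ of $p_n$ (counted with multiplicity) within distance $n^{-(5+\delta)/6}$ of $X_i$; moreover $X_j\ne X_i$ for all $j\neq i$, the sum $\sum_{j\ne i}\frac1{X_i-X_j}$ is nonzero, and $$\left|W_i^{(n)}-X_i+\frac1n\cdot\frac{1}{\frac1{n-1}\sum_{j\neq i}\frac{1}{X_i-X_j}}\right|<\frac1{n^{(3-\delta)/2}},\qquad \left|W_i^{(n)}-X_i\left(1-\tfrac1n\right)\right|<\frac{C}{nc_n}.$$ 3. There is an injection $\iota$ from the set of critical points of $p_n$ in $\mathcal{A}_n$ to $\{1,\dots,n\}$ such that for every critical point $W\in\mathcal{A}_n$ one has $X_{\iota(W)}\in\mathcal{A}_n$, $$W=X_{\iota(W)}\left(1-\tfrac1n+e_W\right)\ \text{ with }\ |e_W|\le\frac{\eta_n}{n},\qquad\text{and}\qquad \left|W-X_{\iota(W)}\left(1-\tfrac1n\right)\right|<\frac{C}{nc_n}.$$ -/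

import Mathlib

open MeasureTheory ProbabilityTheory Filter Asymptotics Polynomial Topology

/-- The closed annulus `{z : 1 - ε ≤ |z| ≤ 1}` at the edge of the unit disk. -/
def edgeAnnulus (ε : ℝ) : Set ℂ := {z | 1 - ε ≤ ‖z‖ ∧ ‖z‖ ≤ 1}

/-- `f` is a density of `μ` with respect to Lebesgue measure inside the set `A`. -/
def IsDensityOn (μ : Measure ℂ) (A : Set ℂ) (f : ℂ → ℝ) : Prop :=
  Measurable f ∧
    μ.restrict A = (volume.restrict A).withDensity (fun z => ENNReal.ofReal (f z))

/-- `μ` is a radially symmetric measure on the closed unit disk which, in some annulus at the edge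
of the disk, has a density whose radial part `2 π r f (r e^{iθ})` is comparable to `(1 - r) ^ α`.
The radius `r = 1` (where the quotient may be `0 / 0`) and the radius `r = 0` (which occurs only
for `ε = 1`) are left out: they carry no Lebesgue measure. -/
structure RadialWithEdgeExponent (μ : Measure ℂ) (α : ℝ) : Prop where
  neg_one_lt : -1 < α
  rotation_invariant : ∀ t : ℝ, μ.map (fun z => Complex.exp (t * Complex.I) * z) = μ
  supported : μ (Metric.closedBall (0 : ℂ) 1)ᶜ = 0
  density : ∃ ε : ℝ, 0 < ε ∧ ε ≤ 1 ∧ ∃ f : ℂ → ℝ, IsDensityOn μ (edgeAnnulus ε) f ∧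
    ∃ c C : ℝ, 0 < c ∧ 0 < C ∧ ∀ r : ℝ, 1 - ε ≤ r → 0 < r → r < 1 → ∀ t : ℝ,
      c ≤ 2 * Real.pi * r * f (r * Complex.exp (t * Complex.I)) / (1 - r) ^ α ∧
      2 * Real.pi * r * f (r * Complex.exp (t * Complex.I)) / (1 - r) ^ α ≤ C

/-- The monic polynomial `∏ (z - x_i)` with roots `x_1, …, x_n`. -/
noncomputable def rootPoly {n : ℕ} (x : Fin n → ℂ) : ℂ[X] :=
  ∏ i, (Polynomial.X - Polynomial.C (x i))

/-- The annulus `{z : 1 - n^{-δ} ≤ |z| ≤ 1}`. -/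
def annulusSeq (n : ℕ) (δ : ℝ) : Set ℂ := edgeAnnulus ((n : ℝ) ^ (-δ))

/-- The set of (distinct) critical points of `∏ (z - x_i)` in the annulus
`{z : 1 - n^{-δ} ≤ |z| ≤ 1}`. -/
def edgeCriticalPoints {n : ℕ} (x : Fin n → ℂ) (δ : ℝ) : Set ℂ :=
  {w | (derivative (rootPoly x)).IsRoot w ∧ w ∈ annulusSeq n δ}

/-- There are at least `N` critical points in the annulus, even without multiplicities. -/
def EnoughCriticalPoints {n : ℕ} (x : Fin n → ℂ) (δ N : ℝ) : Prop :=
  (edgeCriticalPoints x δ).Finite ∧ N ≤ (edgeCriticalPoints x δ).ncard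

/-- The average `(1 / (n - 1)) ∑_{j ≠ i} 1 / (x_i - x_j)`. -/
noncomputable def meanField {n : ℕ} (x : Fin n → ℂ) (i : Fin n) : ℂ :=
  1 / ((n : ℂ) - 1) * ∑ j ∈ Finset.univ.erase i, 1 / (x i - x j)

/-- From roots to critical points. Within distance `n ^ (-(5 + δ) / 6)` of each root `x_i` in the
annulus there is precisely one critical point (counted with multiplicity) `w`, and it has the two
asserted approximations; `c` and `C` are the value `c_n` and the constant in the error term.
The two nondegeneracy clauses say that the expression in the first approximation makes sense. -/
def RootsToCriticalPoints {n : ℕ} (x : Fin n → ℂ) (δ c C : ℝ) : Prop :=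
  ∀ i : Fin n, x i ∈ annulusSeq n δ →
    ∃ w : ℂ,
      (derivative (rootPoly x)).IsRoot w ∧ ‖w - x i‖ ≤ (n : ℝ) ^ (-(5 + δ) / 6) ∧
      (derivative (rootPoly x)).rootMultiplicity w = 1 ∧
      (∀ w' : ℂ, (derivative (rootPoly x)).IsRoot w' →
        ‖w' - x i‖ ≤ (n : ℝ) ^ (-(5 + δ) / 6) → w' = w) ∧
      (∀ j : Fin n, j ≠ i → x j ≠ x i) ∧ meanField x i ≠ 0 ∧
      ‖w - x i + 1 / (n : ℂ) * (1 / meanField x i)‖ < 1 / (n : ℝ) ^ ((3 - δ) / 2) ∧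
      ‖w - x i * (1 - 1 / (n : ℂ))‖ < C / (n * c)

/-- From critical points to roots. There is an injective map `ι` from the critical points in the
annulus to the indices of the roots, with `x_{ι(w)}` in the annulus,
`w = x_{ι(w)} (1 - 1 / n + e)`, `|e| ≤ η / n`, and `|w - x_{ι(w)} (1 - 1 / n)| < C / (n c)`. -/
def CriticalPointsToRoots {n : ℕ} (x : Fin n → ℂ) (δ c C η : ℝ) : Prop :=
  ∃ ι : edgeCriticalPoints x δ → Fin n, Function.Injective ι ∧
    ∀ w : edgeCriticalPoints x δ,
      x (ι w) ∈ annulusSeq n δ ∧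
      (∃ e : ℂ, ‖e‖ ≤ η / n ∧ (w : ℂ) = x (ι w) * (1 - 1 / (n : ℂ) + e)) ∧
      ‖(w : ℂ) - x (ι w) * (1 - 1 / (n : ℂ))‖ < C / (n * c)

/-! Write `p' / p = ∑ 1 / (z - X_j)`. Splitting off one root `X_i` and putting `g_i(z) = ∑_{j ≠ i} 1
/ (z - X_j)`, the critical points near `X_i` are the solutions of `1 + (z - X_i) g_i(z) = 0`, that
is, the fixed points of `z ↦ X_i - 1 / g_i(z)`. By rotation invariance the Cauchy transform of the
mass inside a disk is, outside that disk, that of a point mass at `0`; near the edge almost all mass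
lies further in, so `g_i(z) ≈ n / z` and the fixed point is near `X_i (1 - 1/n)`.

Two facts make this rigorous, and `WellSpread` records them. The energy `∑_{j ≠ i} 1 / |X_i -
X_j|^2` of every root near the edge is at most `S = 2 n^σ` with `σ < (3 + δ) / 2`. This controls
`g_i'`, so the map is a contraction on the disk of radius `R = n^(-(5+δ)/6)`, with exactly one fixed
point there, a simple critical point (`exists_criticalPoint_near`). Also, the field is within `4n /
c_n` of `n / z`, uniformly over points near the edge that are `R`-far from the (other) roots. Hence
the field has no zero `R`-far from all roots, every critical point at the edge lies `R`-close to a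
root, and uniqueness in the disk makes the assignment of roots injective.

Both facts hold outside events of probability `O(1 / c_n)`. The field, cut off at distance `R/2`,
obeys a Chernoff bound with exponent of order `n R / c_n^2`, a power of `n`, which survives a union
bound over a polynomially fine lattice (`wellSpread_of_good` passes from the lattice to all points).
The inverse square is not integrable against a planar density, so the energy has no useful mean.
Markov's inequality is applied instead to the pair sum of `|X_i - X_j|^(-p)` with `p < 2`,
restricted to pairs closer than about `n^(-β)`; its mean is of order `n^(2 - δ(α+1) - βα)`, and
raising to the power `2/p` recovers inverse squares. Remaining pairs cost `O(n^(1+2β))` per root.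
That some `β` keeps both contributions below `n^((3+δ)/2)` is where `δ > 1/(4α+3)` enters. The
condition `δ < 1/(α+1)` makes the number of roots in the annulus a positive power of `n`, so a
Chernoff bound gives the count. -/

/-! ### Critical points near a well separated root. -/

section Deterministic

/-- The logarithmic derivative of `∏ (z - x_j)`, away from the roots. -/
noncomputable def reciprocalSum {ι : Type*} (s : Finset ι) (x : ι → ℂ) (z : ℂ) : ℂ :=
  ∑ j ∈ s, 1 / (z - x j)

variable {ι : Type*} (s : Finset ι) (x : ι → ℂ)

theorem eval_prod_X_sub_C_ne_zero {z : ℂ} (h : ∀ j ∈ s, z ≠ x j) :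
    (∏ j ∈ s, (X - C (x j))).eval z ≠ 0 := by
  rw [eval_prod, Finset.prod_ne_zero_iff]
  intro j hj
  simpa [sub_eq_zero] using h j hj

theorem eval_derivative_prod_X_sub_C {z : ℂ} (h : ∀ j ∈ s, z ≠ x j) :
    (derivative (∏ j ∈ s, (X - C (x j)))).eval z =
      (∏ j ∈ s, (X - C (x j))).eval z * reciprocalSum s x z := by
  classical
  unfold reciprocalSum
  induction s using Finset.induction_on with
  | empty => simp
  | insert a s ha ih =>
    have h1 : z - x a ≠ 0 := sub_ne_zero.2 (h a (Finset.mem_insert_self _ _))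
    rw [Finset.prod_insert ha, Finset.sum_insert ha, derivative_mul, eval_add, eval_mul, eval_mul,
      ih fun j hj => h j (Finset.mem_insert_of_mem hj)]
    simp only [derivative_sub, derivative_X, derivative_C, eval_sub, eval_one, eval_zero, eval_X,
      eval_C, eval_mul]
    field_simp
    ring

theorem hasDerivAt_reciprocalSum {z : ℂ} (h : ∀ j ∈ s, z ≠ x j) :
    HasDerivAt (reciprocalSum s x) (-∑ j ∈ s, 1 / (z - x j) ^ 2) z := by
  have : ∀ j ∈ s, HasDerivAt (fun z => 1 / (z - x j)) (-(1 / (z - x j) ^ 2)) z := by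
    intro j hj
    have h1 : z - x j ≠ 0 := sub_ne_zero.2 (h j hj)
    have := ((hasDerivAt_id' z).sub_const (x j)).fun_inv h1
    simpa [one_div, neg_div] using this
  have h2 := HasDerivAt.fun_sum this
  rw [Finset.sum_neg_distrib] at h2
  exact h2

variable {s x}

theorem half_dist_le {a z y : ℂ} {R : ℝ} (hz : ‖z - a‖ ≤ R) (h : 2 * R ≤ ‖a - y‖) :
    ‖a - y‖ / 2 ≤ ‖z - y‖ := by
  have h2 : ‖a - y‖ ≤ ‖z - y‖ + ‖z - a‖ := by
    calc ‖a - y‖ = ‖(z - y) - (z - a)‖ := by congr 1; ring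
      _ ≤ _ := norm_sub_le _ _
  linarith

theorem norm_reciprocalSum_sub_le {a z w : ℂ} {R : ℝ} (hR : 0 < R)
    (h : ∀ j ∈ s, 2 * R ≤ ‖a - x j‖) (hz : ‖z - a‖ ≤ R) (hw : ‖w - a‖ ≤ R) :
    ‖reciprocalSum s x z - reciprocalSum s x w‖ ≤
      4 * ‖z - w‖ * ∑ j ∈ s, 1 / ‖a - x j‖ ^ 2 := by
  unfold reciprocalSum
  rw [← Finset.sum_sub_distrib, Finset.mul_sum]
  refine norm_sum_le_of_le _ fun j hj => ?_
  have ha : 0 < ‖a - x j‖ := by linarith [h j hj]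
  have h1 := half_dist_le hz (h j hj)
  have h2 := half_dist_le hw (h j hj)
  have hz0 : z - x j ≠ 0 := norm_pos_iff.1 (by linarith)
  have hw0 : w - x j ≠ 0 := norm_pos_iff.1 (by linarith)
  have : 1 / (z - x j) - 1 / (w - x j) = -(z - w) / ((z - x j) * (w - x j)) := by
    field_simp; ring
  rw [this, norm_div, norm_neg, norm_mul, mul_one_div]
  have h3 : ‖a - x j‖ / 2 * (‖a - x j‖ / 2) ≤ ‖z - x j‖ * ‖w - x j‖ :=
    mul_le_mul h1 h2 (by positivity) (by positivity)
  rw [div_le_div_iff₀ (by nlinarith) (by positivity)]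
  nlinarith [norm_nonneg (z - w)]

theorem norm_sum_one_div_sq_le {a z : ℂ} {R : ℝ} (hR : 0 < R)
    (h : ∀ j ∈ s, 2 * R ≤ ‖a - x j‖) (hz : ‖z - a‖ ≤ R) :
    ‖-∑ j ∈ s, 1 / (z - x j) ^ 2‖ ≤ 4 * ∑ j ∈ s, 1 / ‖a - x j‖ ^ 2 := by
  rw [norm_neg, Finset.mul_sum]
  refine norm_sum_le_of_le _ fun j hj => ?_
  have ha : 0 < ‖a - x j‖ := by linarith [h j hj]
  have h1 := half_dist_le hz (h j hj)
  have hz0 : 0 < ‖z - x j‖ := by linarith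
  rw [norm_div, norm_one, norm_pow, mul_one_div, div_le_div_iff₀ (by positivity) (by positivity)]
  nlinarith

/-- A critical point of `∏ (z - x_j)` near a root that is well separated from the others and at
which the field of the other roots is close to `n / x_i`. -/
theorem exists_criticalPoint_near {n : ℕ} {x : Fin n → ℂ} {i : Fin n} {R S κ : ℝ}
    (hn : 0 < n) (hx : ‖x i‖ ≤ 1) (hx0 : x i ≠ 0)
    (hsep : ∀ j ≠ i, 2 * R ≤ ‖x i - x j‖)
    (hS : ∑ j ∈ Finset.univ.erase i, 1 / ‖x i - x j‖ ^ 2 ≤ S)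
    (hκ : ‖reciprocalSum (Finset.univ.erase i) x (x i) - n / x i‖ ≤ n * κ) (hκ1 : κ ≤ 1 / 4)
    (hnR : 2 / n ≤ R) (hRS : 4 * R * S ≤ n / 4) (hSn : 32 * S ≤ (n : ℝ) ^ 2) :
    (n : ℝ) / 2 ≤ ‖reciprocalSum (Finset.univ.erase i) x (x i)‖ ∧
    ∃ w : ℂ, (derivative (rootPoly x)).IsRoot w ∧ ‖w - x i‖ ≤ 2 / n ∧
      (derivative (rootPoly x)).rootMultiplicity w = 1 ∧
      (∀ w' : ℂ, (derivative (rootPoly x)).IsRoot w' → ‖w' - x i‖ ≤ R → w' = w) ∧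
      ‖w - x i + 1 / reciprocalSum (Finset.univ.erase i) x (x i)‖ ≤ 32 * S / n ^ 3 ∧
      ‖w - x i * (1 - 1 / (n : ℂ))‖ ≤ (2 * κ + 16 * S / n ^ 2) / n := by
  set s := Finset.univ.erase i with hs
  set g := reciprocalSum s x with hg
  have hn' : (0 : ℝ) < n := by exact_mod_cast hn
  have hR : 0 < R := lt_of_lt_of_le (by positivity) hnR
  have hsep' : ∀ j ∈ s, 2 * R ≤ ‖x i - x j‖ := fun j hj => hsep j (Finset.ne_of_mem_erase hj)
  have hne : ∀ z, ‖z - x i‖ ≤ R → ∀ j ∈ s, z ≠ x j := by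
    intro z hz j hj h
    have := half_dist_le hz (hsep' j hj)
    have h2 := hsep' j hj
    rw [h, sub_self, norm_zero] at this
    linarith
  have hlip : ∀ z w, ‖z - x i‖ ≤ R → ‖w - x i‖ ≤ R → ‖g z - g w‖ ≤ 4 * ‖z - w‖ * S := by
    intro z w hz hw
    exact (norm_reciprocalSum_sub_le hR hsep' hz hw).trans
      (mul_le_mul_of_nonneg_left hS (by positivity))
  have hS0 : 0 ≤ S := le_trans (Finset.sum_nonneg fun j _ => by positivity) hS
  -- `|n / x_i| ≥ n` because `|x_i| ≤ 1`, and the error is at most `n/4`. The Lipschitz bound then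
  -- costs another `n/4` over the disk.
  have hgi : 3 * (n : ℝ) / 4 ≤ ‖g (x i)‖ := by
    have h1 : (n : ℝ) ≤ ‖(n : ℂ) / x i‖ := by
      rw [norm_div, Complex.norm_natCast, le_div_iff₀ (norm_pos_iff.2 hx0)]
      nlinarith
    have h2 := norm_sub_norm_le ((n : ℂ) / x i) (g (x i))
    rw [norm_sub_rev] at h2
    nlinarith
  have hxi : ‖x i - x i‖ ≤ R := by simpa using hR.le
  have hgl : ∀ z, ‖z - x i‖ ≤ R → (n : ℝ) / 2 ≤ ‖g z‖ := by
    intro z hz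
    have h1 := hlip z (x i) hz hxi
    have h2 := norm_sub_norm_le (g (x i)) (g z)
    rw [norm_sub_rev] at h2
    have : 4 * ‖z - x i‖ * S ≤ 4 * R * S := by gcongr
    linarith
  have hg0 : ∀ z, ‖z - x i‖ ≤ R → g z ≠ 0 := fun z hz =>
    norm_pos_iff.1 (lt_of_lt_of_le (by positivity) (hgl z hz))
  have hginv : ∀ z, ‖z - x i‖ ≤ R → ‖1 / g z‖ ≤ 2 / n := by
    intro z hz
    rw [norm_div, norm_one, div_le_div_iff₀ (norm_pos_iff.2 (hg0 z hz)) hn']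
    linarith [hgl z hz]
  have hgsub : ∀ z w, ‖z - x i‖ ≤ R → ‖w - x i‖ ≤ R →
      ‖1 / g z - 1 / g w‖ ≤ 16 * S / n ^ 2 * ‖z - w‖ := by
    intro z w hz hw
    have e : 1 / g z - 1 / g w = (g w - g z) * (1 / g z) * (1 / g w) := by
      have := hg0 z hz
      have := hg0 w hw
      field_simp
    rw [e, norm_mul, norm_mul]
    calc ‖g w - g z‖ * ‖1 / g z‖ * ‖1 / g w‖ ≤ (4 * ‖w - z‖ * S) * (2 / n) * (2 / n) := by
          gcongr
          · exact hlip w z hw hz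
          · exact hginv z hz
          · exact hginv w hw
      _ = _ := by rw [norm_sub_rev]; ring
  -- `1 / g` has Lipschitz constant `16 S / n^2`, which `32 S ≤ n^2` makes at most `1/2`.
  have hcon : ∀ z w, ‖z - x i‖ ≤ R → ‖w - x i‖ ≤ R →
      ‖1 / g z - 1 / g w‖ ≤ 1 / 2 * ‖z - w‖ := by
    intro z w hz hw
    refine (hgsub z w hz hw).trans (mul_le_mul_of_nonneg_right ?_ (norm_nonneg _))
    rw [div_le_div_iff₀ (by positivity) (by norm_num)]
    linarith
  -- the fixed point
  have hfix : ∃ w, ‖w - x i‖ ≤ R ∧ x i - 1 / g w = w := by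
    have hmaps : Set.MapsTo (fun z => x i - 1 / g z) (Metric.closedBall (x i) R)
        (Metric.closedBall (x i) R) := by
      intro z hz
      rw [Metric.mem_closedBall, dist_eq_norm] at hz ⊢
      have : x i - 1 / g z - x i = -(1 / g z) := by ring
      rw [this, norm_neg]
      exact (hginv z hz).trans hnR
    have hc : ContractingWith (1 / 2) hmaps.restrict := by
      refine ⟨by norm_num [← NNReal.coe_lt_coe], LipschitzWith.of_dist_le_mul ?_⟩
      rintro ⟨z, hz⟩ ⟨w, hw⟩
      rw [Metric.mem_closedBall, dist_eq_norm] at hz hw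
      simp only [Subtype.dist_eq, Set.MapsTo.val_restrict_apply, dist_eq_norm]
      have : x i - 1 / g z - (x i - 1 / g w) = -(1 / g z - 1 / g w) := by ring
      rw [this, norm_neg]
      simpa using hcon z w hz hw
    obtain ⟨w, hw, hfw, -⟩ := ContractingWith.exists_fixedPoint'
      (Metric.isClosed_closedBall.isComplete) hmaps hc
      (Metric.mem_closedBall_self hR.le) (edist_ne_top _ _)
    exact ⟨w, by simpa [dist_eq_norm] using hw, hfw⟩
  obtain ⟨w, hwR, hw⟩ := hfix
  -- the derivative near `x i`
  set q : ℂ[X] := ∏ j ∈ s, (X - C (x j)) with hq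
  have hpq : rootPoly x = (X - C (x i)) * q := by
    rw [rootPoly, hq, hs]
    exact (Finset.mul_prod_erase _ (fun j => X - C (x j)) (Finset.mem_univ i)).symm
  -- Product rule with `q' = q g`. Since `q` has no zero in the disk, the roots of the derivative
  -- there are exactly the fixed points.
  have hev : ∀ z, (∀ j ∈ s, z ≠ x j) →
      (derivative (rootPoly x)).eval z = q.eval z * (1 + (z - x i) * g z) := by
    intro z hz
    rw [hpq, derivative_mul, eval_add, eval_mul, eval_mul, hq,
      eval_derivative_prod_X_sub_C s x hz]
    simp
    ring
  have hroot : ∀ z, ‖z - x i‖ ≤ R → ((derivative (rootPoly x)).IsRoot z ↔ x i - 1 / g z = z) := by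
    intro z hz
    rw [IsRoot.def, hev z (hne z hz), mul_eq_zero,
      or_iff_right (eval_prod_X_sub_C_ne_zero s x (hne z hz))]
    have := hg0 z hz
    constructor
    · intro h
      field_simp
      linear_combination -h
    · intro h
      rw [← sub_eq_zero] at h
      field_simp at h
      linear_combination -h
  have huniq : ∀ w' : ℂ, (derivative (rootPoly x)).IsRoot w' → ‖w' - x i‖ ≤ R → w' = w := by
    intro w' h1 h2
    have h3 := (hroot w' h2).1 h1
    have h4 := hcon w w' hwR h2
    have h5 : 1 / g w - 1 / g w' = -(w - w') := by linear_combination h3 - hw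
    rw [h5, norm_neg] at h4
    have h6 : ‖w - w'‖ ≤ 0 := by linarith [norm_nonneg (w - w')]
    exact (sub_eq_zero.1 (norm_le_zero_iff.1 h6)).symm
  have hwx : w - x i = -(1 / g w) := by linear_combination -hw
  have hwn : ‖w - x i‖ ≤ 2 / n := by rw [hwx, norm_neg]; exact hginv w hwR
  -- simplicity
  have hsimple : (derivative (derivative (rootPoly x))).eval w ≠ 0 := by
    set g' : ℂ := -∑ j ∈ s, 1 / (w - x j) ^ 2 with hg'
    have hgd : HasDerivAt g g' w := hasDerivAt_reciprocalSum s x (hne w hwR)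
    have hF : HasDerivAt (fun z => q.eval z * (1 + (z - x i) * g z))
        (q.eval w * (g w + (w - x i) * g')) w := by
      have h1 := (q.hasDerivAt w).fun_mul
        ((((hasDerivAt_id' w).sub_const (x i)).fun_mul hgd).const_add 1)
      have hz : 1 + (w - x i) * g w = 0 := by
        have := hg0 w hwR
        rw [hwx]; field_simp; ring
      exact h1.congr_deriv (by rw [hz]; ring)
    have hopen : ∀ᶠ z in 𝓝 w, ∀ j ∈ s, z ≠ x j := by
      rw [Filter.eventually_all_finset]
      intro j hj
      exact isOpen_ne.mem_nhds (hne w hwR j hj)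
    have hF' : HasDerivAt (fun z => (derivative (rootPoly x)).eval z)
        (q.eval w * (g w + (w - x i) * g')) w :=
      hF.congr_of_eventuallyEq (hopen.mono fun z hz => hev z hz)
    rw [((derivative (rootPoly x)).hasDerivAt w).unique hF']
    refine mul_ne_zero (eval_prod_X_sub_C_ne_zero s x (hne w hwR)) ?_
    intro h0
    -- At a double root `g + (w - x_i) g' = 0` with `w - x_i = -1/g`. This is impossible: `|g|^2 ≥
    -- n^2/4`, whereas `|g'| ≤ 4S ≤ n^2/8`.
    have h1 : g w ^ 2 = g' := by
      have := hg0 w hwR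
      rw [hwx] at h0
      field_simp at h0
      linear_combination h0
    have h2 : ‖g'‖ ≤ 4 * S := (norm_sum_one_div_sq_le hR hsep' hwR).trans (by linarith)
    rw [← h1, norm_pow] at h2
    have h3 := hgl w hwR
    have h4 : ((n : ℝ) / 2) ^ 2 ≤ ‖g w‖ ^ 2 := by gcongr
    nlinarith
  have hwroot := (hroot w hwR).2 hw
  have hp0 : derivative (rootPoly x) ≠ 0 := by
    intro h
    rw [h] at hsimple
    simp at hsimple
  refine ⟨hgl _ hxi, w, hwroot, hwn, ?_, huniq, ?_, ?_⟩
  · have h1 : 0 < (derivative (rootPoly x)).rootMultiplicity w :=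
      (rootMultiplicity_pos hp0).2 hwroot
    have h2 := (one_lt_rootMultiplicity_iff_isRoot (t := w) hp0).not.2 (fun h => hsimple h.2)
    omega
  · have h1 : w - x i + 1 / g (x i) = 1 / g (x i) - 1 / g w := by rw [hwx]; ring
    rw [h1]
    refine (hgsub _ _ hxi hwR).trans ?_
    rw [norm_sub_rev]
    calc 16 * S / n ^ 2 * ‖w - x i‖ ≤ 16 * S / n ^ 2 * (2 / n) := by gcongr
      _ = _ := by field_simp; ring
  · have hnc : (n : ℂ) ≠ 0 := by exact_mod_cast hn.ne'
    have h1 : w - x i * (1 - 1 / (n : ℂ)) = x i * (1 / n) * (1 / g w) * (g w - n / x i) := by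
      have := hg0 w hwR
      have h2 : w = x i - 1 / g w := hw.symm
      conv_lhs => rw [h2]
      field_simp
      ring
    have h2 : ‖g w - n / x i‖ ≤ 4 * (2 / n) * S + n * κ := by
      calc ‖g w - n / x i‖ = ‖(g w - g (x i)) + (g (x i) - n / x i)‖ := by congr 1; ring
        _ ≤ ‖g w - g (x i)‖ + ‖g (x i) - n / x i‖ := norm_add_le _ _
        _ ≤ _ := add_le_add ((hlip w (x i) hwR hxi).trans (by gcongr)) hκ
    rw [h1, norm_mul, norm_mul, norm_mul]
    have h3 : ‖(1 : ℂ) / n‖ = 1 / n := by simp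
    rw [h3]
    calc ‖x i‖ * (1 / n) * ‖1 / g w‖ * ‖g w - n / x i‖
        ≤ 1 * (1 / n) * (2 / n) * (4 * (2 / n) * S + n * κ) := by
          gcongr
          exact hginv w hwR
      _ = _ := by field_simp; ring

/-- A point away from the roots at which the field of the roots does not vanish is not critical. -/
theorem not_isRoot_derivative_rootPoly {n : ℕ} {x : Fin n → ℂ} {z : ℂ} (h : ∀ j, z ≠ x j)
    (h0 : reciprocalSum Finset.univ x z ≠ 0) : ¬ (derivative (rootPoly x)).IsRoot z := by
  rw [IsRoot.def, rootPoly, eval_derivative_prod_X_sub_C _ _ fun j _ => h j]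
  exact mul_ne_zero (eval_prod_X_sub_C_ne_zero _ _ fun j _ => h j) h0

end Deterministic

/-! ### Two-sided mass bounds at the edge of the disk. -/

section EdgeMeasure

theorem edgeAnnulus_eq_diff (t : ℝ) :
    edgeAnnulus t = Metric.closedBall 0 1 \ Metric.ball 0 (1 - t) := by
  ext z
  simp [edgeAnnulus, and_comm]

theorem measurableSet_edgeAnnulus (t : ℝ) : MeasurableSet (edgeAnnulus t) := by
  rw [edgeAnnulus_eq_diff]
  exact measurableSet_closedBall.diff measurableSet_ball

theorem edgeAnnulus_mono {s t : ℝ} (h : s ≤ t) : edgeAnnulus s ⊆ edgeAnnulus t :=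
  fun _ hz => ⟨by linarith [hz.1], hz.2⟩

/-- The consequences of the edge density that are used: two-sided bounds at scale `t ≤ ε`. -/
structure EdgeRegular (μ : Measure ℂ) (α ε k K : ℝ) : Prop where
  nonneg : 0 ≤ α
  eps_pos : 0 < ε
  eps_le : ε ≤ 1 / 2
  lower_pos : 0 < k
  upper_pos : 0 < K
  rotation_invariant : ∀ t : ℝ, μ.map (fun z => Complex.exp (t * Complex.I) * z) = μ
  supported : ∀ᵐ z ∂μ, ‖z‖ ≤ 1
  le_measure : ∀ t : ℝ, 0 < t → t ≤ ε → ENNReal.ofReal (k * t ^ (α + 1)) ≤ μ (edgeAnnulus t)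
  lintegral_le : ∀ t : ℝ, 0 < t → t ≤ ε → ∀ φ : ℂ → ENNReal, Measurable φ →
    ∫⁻ z in edgeAnnulus t, φ z ∂μ ≤ ENNReal.ofReal (K * t ^ α) * ∫⁻ z in edgeAnnulus t, φ z

theorem volume_ball_zero (r : ℝ) (hr : 0 ≤ r) :
    volume (Metric.ball (0 : ℂ) r) = ENNReal.ofReal (Real.pi * r ^ 2) := by
  rw [Complex.volume_ball, mul_comm, ENNReal.ofReal_mul Real.pi_pos.le, ENNReal.ofReal_pow hr]
  congr 1
  exact (ENNReal.ofReal_eq_coe_nnreal Real.pi_pos.le).symm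

theorem volume_closedBall_zero (r : ℝ) (hr : 0 ≤ r) :
    volume (Metric.closedBall (0 : ℂ) r) = ENNReal.ofReal (Real.pi * r ^ 2) := by
  rw [Complex.volume_closedBall, mul_comm, ENNReal.ofReal_mul Real.pi_pos.le,
    ENNReal.ofReal_pow hr]
  congr 1
  exact (ENNReal.ofReal_eq_coe_nnreal Real.pi_pos.le).symm

theorem volume_edgeAnnulus_le {t : ℝ} (h0 : 0 ≤ t) (h1 : t ≤ 1) :
    volume (edgeAnnulus t) ≤ ENNReal.ofReal (2 * Real.pi * t) := by
  rw [edgeAnnulus_eq_diff, measure_sdiff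
    ((Metric.ball_subset_ball (by linarith)).trans Metric.ball_subset_closedBall)
    measurableSet_ball.nullMeasurableSet measure_ball_lt_top.ne,
    volume_ball_zero _ (by linarith), volume_closedBall_zero _ zero_le_one,
    ← ENNReal.ofReal_sub _ (by positivity)]
  refine ENNReal.ofReal_le_ofReal ?_
  nlinarith [Real.pi_pos, sq_nonneg t, mul_nonneg Real.pi_pos.le (sq_nonneg t)]

/-- For `α ≥ 0` the factor `(1 - r)^α` is at most `t^α` on the annulus of width `t`, and at least
`(t/2)^α` on its inner half, whose area is of order `t`. Shrinking `ε` to at most `1/2` keeps `2πr`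
between `1` and `2π`. -/
theorem RadialWithEdgeExponent.edgeRegular {μ : Measure ℂ} {α : ℝ} (hα : 0 ≤ α)
    (hμ : RadialWithEdgeExponent μ α) : ∃ ε k K, EdgeRegular μ α ε k K := by
  obtain ⟨ε, hε0, hε1, f, ⟨hfm, hf⟩, c, C, hc, hC, hb⟩ := hμ.density
  have hpi := Real.pi_pos
  have hpi3 := Real.pi_gt_three
  have hrestrict : ∀ t, t ≤ ε → ∀ s ⊆ edgeAnnulus t, MeasurableSet s → μ.restrict s =
      (volume.restrict s).withDensity (fun z => ENNReal.ofReal (f z)) := by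
    intro t ht s hs hsm
    have h1 := congrArg (fun ν => ν.restrict s) hf
    rw [restrict_withDensity hsm, Measure.restrict_restrict hsm, Measure.restrict_restrict hsm,
      Set.inter_eq_left.2 (hs.trans (edgeAnnulus_mono ht))] at h1
    exact h1
  have hpolar : ∀ z : ℂ, (‖z‖ : ℂ) * Complex.exp (z.arg * Complex.I) = z :=
    fun z => Complex.norm_mul_exp_arg_mul_I z
  have hup : ∀ t, t ≤ ε → t ≤ 1 / 2 → ∀ z ∈ edgeAnnulus t, ‖z‖ ≠ 1 → f z ≤ C * t ^ α := by
    intro t ht ht2 z hz hz1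
    have hr1 : ‖z‖ < 1 := lt_of_le_of_ne hz.2 hz1
    have hr2 : 1 / 2 ≤ ‖z‖ := by linarith [hz.1]
    have h := (hb ‖z‖ (by linarith [hz.1]) (by linarith) hr1 z.arg).2
    rw [hpolar, div_le_iff₀ (Real.rpow_pos_of_pos (by linarith) _)] at h
    have h2 : (1 - ‖z‖) ^ α ≤ t ^ α :=
      Real.rpow_le_rpow (by linarith) (by linarith [hz.1]) hα
    have h3 : C * (1 - ‖z‖) ^ α ≤ C * t ^ α := mul_le_mul_of_nonneg_left h2 hC.le
    by_cases hfz : 0 ≤ f z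
    · have h4 : 1 ≤ 2 * Real.pi * ‖z‖ := by nlinarith
      nlinarith
    · have : 0 ≤ C * t ^ α := mul_nonneg hC.le
        (Real.rpow_nonneg (by linarith [hz.1, hz.2]) _)
      linarith
  have hlow : ∀ t, 0 < t → t ≤ ε → t ≤ 1 / 2 → ∀ z : ℂ, 1 - t ≤ ‖z‖ → ‖z‖ < 1 - t / 2 →
      c * (t / 2) ^ α / (2 * Real.pi) ≤ f z := by
    intro t ht0 ht ht2 z hz hz1
    have hr2 : 1 / 2 ≤ ‖z‖ := by linarith
    have h := (hb ‖z‖ (by linarith) (by linarith) (by linarith) z.arg).1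
    rw [hpolar, le_div_iff₀ (Real.rpow_pos_of_pos (by linarith) _)] at h
    have h2 : (t / 2) ^ α ≤ (1 - ‖z‖) ^ α :=
      Real.rpow_le_rpow (by linarith) (by linarith) hα
    have h3 : c * (t / 2) ^ α ≤ c * (1 - ‖z‖) ^ α := mul_le_mul_of_nonneg_left h2 hc.le
    have h5 : 0 < c * (t / 2) ^ α := mul_pos hc (Real.rpow_pos_of_pos (by linarith) _)
    have hfz : 0 ≤ f z := by
      by_contra hneg
      push Not at hneg
      have : 2 * Real.pi * ‖z‖ * f z < 0 := mul_neg_of_pos_of_neg (by positivity) hneg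
      linarith
    rw [div_le_iff₀ (by positivity)]
    nlinarith [mul_nonneg hpi.le hfz]
  refine ⟨min ε (1 / 2), c * (1 / 2) ^ α / 4, C, hα, by positivity, min_le_right _ _,
    by positivity, hC, hμ.rotation_invariant, ?_, ?_, ?_⟩
  · have := hμ.supported
    rw [ae_iff]
    convert this using 2
    ext z
    simp
  · intro t ht0 ht
    have ht1 : t ≤ ε := ht.trans (min_le_left _ _)
    have ht2 : t ≤ 1 / 2 := ht.trans (min_le_right _ _)
    set s := Metric.ball (0 : ℂ) (1 - t / 2) \ Metric.ball 0 (1 - t) with hs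
    have hsm : MeasurableSet s := measurableSet_ball.diff measurableSet_ball
    have hsub : s ⊆ edgeAnnulus t := by
      intro z hz
      simp only [hs, Set.mem_sdiff, mem_ball_zero_iff, not_lt] at hz
      exact ⟨hz.2, by linarith⟩
    calc ENNReal.ofReal (c * (1 / 2) ^ α / 4 * t ^ (α + 1))
        ≤ ENNReal.ofReal (c * (t / 2) ^ α / (2 * Real.pi) *
            (Real.pi * (1 - t / 2) ^ 2 - Real.pi * (1 - t) ^ 2)) := by
          refine ENNReal.ofReal_le_ofReal ?_
          rw [Real.rpow_add_one ht0.ne', show t / 2 = 1 / 2 * t by ring,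
            Real.mul_rpow (by norm_num) ht0.le]
          have hA : 0 < c * ((1 / 2) ^ α * t ^ α) :=
            mul_pos hc (mul_pos (by positivity) (Real.rpow_pos_of_pos ht0 _))
          have : c * ((1 / 2) ^ α * t ^ α) / (2 * Real.pi) *
            (Real.pi * (1 - 1 / 2 * t) ^ 2 - Real.pi * (1 - t) ^ 2) =
            c * ((1 / 2) ^ α * t ^ α) * ((1 - 1 / 2 * t) ^ 2 - (1 - t) ^ 2) / 2 := by
            field_simp
          rw [this]
          have h2 : t / 2 ≤ (1 - 1 / 2 * t) ^ 2 - (1 - t) ^ 2 := by nlinarith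
          nlinarith
      _ = ENNReal.ofReal (c * (t / 2) ^ α / (2 * Real.pi)) * volume s := by
          rw [hs, measure_sdiff (Metric.ball_subset_ball (by linarith))
            measurableSet_ball.nullMeasurableSet measure_ball_lt_top.ne,
            volume_ball_zero _ (by linarith), volume_ball_zero _ (by linarith),
            ← ENNReal.ofReal_sub _ (by positivity), ← ENNReal.ofReal_mul (by positivity)]
      _ = ∫⁻ z in s, ENNReal.ofReal (c * (t / 2) ^ α / (2 * Real.pi)) := by
          rw [setLIntegral_const]
      _ ≤ ∫⁻ z in s, ENNReal.ofReal (f z) := by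
          refine setLIntegral_mono' hsm fun z hz => ENNReal.ofReal_le_ofReal ?_
          simp only [hs, Set.mem_sdiff, mem_ball_zero_iff, not_lt] at hz
          exact hlow t ht0 ht1 ht2 z hz.2 hz.1
      _ = μ s := by
          have h1 := congrArg (fun ν => ν Set.univ) (hrestrict t ht1 s hsub hsm)
          simpa using h1.symm
      _ ≤ μ (edgeAnnulus t) := measure_mono hsub
  · intro t ht0 ht φ hφ
    have ht1 : t ≤ ε := ht.trans (min_le_left _ _)
    have ht2 : t ≤ 1 / 2 := ht.trans (min_le_right _ _)
    rw [hrestrict t ht1 _ subset_rfl (measurableSet_edgeAnnulus t),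
      lintegral_withDensity_eq_lintegral_mul _ hfm.ennreal_ofReal hφ, ← lintegral_const_mul _ hφ]
    refine lintegral_mono_ae ?_
    -- The density is not controlled on the unit circle, which is Lebesgue null.
    have h1 : ∀ᵐ z : ℂ, ‖z‖ ≠ 1 := by
      rw [ae_iff]
      convert Measure.addHaar_sphere (volume : Measure ℂ) 0 1 using 2
      ext z
      simp
    filter_upwards [ae_restrict_of_ae h1, ae_restrict_mem (measurableSet_edgeAnnulus t)]
      with z hz hz2
    exact mul_le_mul_left (ENNReal.ofReal_le_ofReal (hup t ht1 ht2 z hz2 hz)) _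

/-- In polar coordinates the integrand becomes `r^(1-p)`, integrable at `0` when `p < 2`. This is
the source of the restriction `p < 2` on all later energies. -/
theorem lintegral_ball_enorm_rpow_lt_top {p : ℝ} (hp : p < 2) :
    ∫⁻ z in Metric.ball (0 : ℂ) 1, ‖z‖ₑ ^ (-p) < ⊤ := by
  have h : IntegrableOn (fun z : ℂ => ‖z‖ ^ (-p)) (Metric.ball 0 1) := by
    rw [integrableOn_fun_norm_addHaar volume (f := fun r => r ^ (-p))]
    have h1 : IntegrableOn (fun y : ℝ => y ^ (1 - p)) (Set.Ioo 0 1) := by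
      have := (intervalIntegral.intervalIntegrable_rpow' (a := 0) (b := 1)
        (show -1 < 1 - p by linarith))
      rw [intervalIntegrable_iff_integrableOn_Ioo_of_le zero_le_one] at this
      exact this
    refine h1.congr_fun (fun y hy => ?_) measurableSet_Ioo
    simp only [Complex.finrank_real_complex, smul_eq_mul]
    rw [show (1 - p) = (1 : ℝ) + -p by ring, Real.rpow_add hy.1]
    simp
  refine lt_of_eq_of_lt ?_ h.2
  refine lintegral_congr_ae (ae_restrict_of_ae ?_)
  have h0 : ∀ᵐ z : ℂ, z ≠ 0 := by
    simp [ae_iff]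
  filter_upwards [h0] with z hz
  rw [Real.enorm_eq_ofReal (by positivity), ← ofReal_norm,
    ENNReal.ofReal_rpow_of_pos (norm_pos_iff.2 hz)]

end EdgeMeasure

/-! ### Singular kernels and the Cauchy transform of a radial measure. -/

section Kernel

variable {μ : Measure ℂ} {α ε k K : ℝ}

theorem measurable_enorm_sub_rpow (z : ℂ) (p : ℝ) : Measurable fun u : ℂ => ‖z - u‖ₑ ^ p := by
  fun_prop

theorem EdgeRegular.measure_edgeAnnulus_le (h : EdgeRegular μ α ε k K) {t : ℝ} (ht : 0 < t)
    (htε : t ≤ ε) : μ (edgeAnnulus t) ≤ ENNReal.ofReal (2 * Real.pi * K * t ^ (α + 1)) := by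
  have h1 := h.lintegral_le t ht htε (fun _ => 1) measurable_const
  simp only [lintegral_const, Measure.restrict_apply MeasurableSet.univ, Set.univ_inter,
    one_mul] at h1
  refine h1.trans ((mul_le_mul_right (volume_edgeAnnulus_le ht.le
    (by linarith [h.eps_le])) _).trans ?_)
  have hK := h.upper_pos
  rw [← ENNReal.ofReal_mul (mul_nonneg hK.le (Real.rpow_nonneg ht.le _)),
    Real.rpow_add_one ht.ne']
  exact ENNReal.ofReal_le_ofReal (le_of_eq (by ring))

/-- Near a point at the edge, the kernel `|z - u| ^ (-p)` has an integral of the order of the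
density. -/
theorem EdgeRegular.exists_setLIntegral_le (h : EdgeRegular μ α ε k K) {p : ℝ}
    (hp : p < 2) : ∃ L : ℝ, 0 < L ∧ ∀ t : ℝ, 0 < t → 2 * t ≤ ε → ∀ z : ℂ, 1 - t ≤ ‖z‖ →
      ∫⁻ u in Metric.closedBall z t, ‖z - u‖ₑ ^ (-p) ∂μ ≤ ENNReal.ofReal (L * t ^ α) := by
  set N := ∫⁻ z in Metric.ball (0 : ℂ) 1, ‖z‖ₑ ^ (-p) with hN
  have hNt : N < ⊤ := lintegral_ball_enorm_rpow_lt_top hp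
  have hK := h.upper_pos
  refine ⟨K * 2 ^ α * (N.toReal + 1), by positivity, fun t ht htε z hz => ?_⟩
  have hε := h.eps_le
  calc ∫⁻ u in Metric.closedBall z t, ‖z - u‖ₑ ^ (-p) ∂μ
      = ∫⁻ u, (Metric.closedBall z t).indicator (fun u => ‖z - u‖ₑ ^ (-p)) u ∂μ :=
        (lintegral_indicator measurableSet_closedBall _).symm
    _ ≤ ∫⁻ u in edgeAnnulus (2 * t),
          (Metric.closedBall z t).indicator (fun u => ‖z - u‖ₑ ^ (-p)) u ∂μ := by
        rw [← lintegral_indicator (measurableSet_edgeAnnulus _)]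
        refine lintegral_mono_ae ?_
        filter_upwards [h.supported] with u hu
        by_cases hu2 : u ∈ Metric.closedBall z t
        · have : u ∈ edgeAnnulus (2 * t) := by
            refine ⟨?_, hu⟩
            rw [Metric.mem_closedBall, dist_eq_norm, norm_sub_rev] at hu2
            have := norm_sub_norm_le z u
            linarith
          rw [Set.indicator_of_mem this]
        · rw [Set.indicator_of_notMem hu2]
          exact zero_le
    _ ≤ ENNReal.ofReal (K * (2 * t) ^ α) * ∫⁻ u in edgeAnnulus (2 * t),
          (Metric.closedBall z t).indicator (fun u => ‖z - u‖ₑ ^ (-p)) u :=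
        h.lintegral_le _ (by linarith) htε _
          ((measurable_enorm_sub_rpow z _).indicator measurableSet_closedBall)
    -- The gain `t^α` comes from the density alone; the kernel is integrated over the whole unit
    -- ball around `z`, which contains the ball of radius `t`.
    _ ≤ ENNReal.ofReal (K * (2 * t) ^ α) * N := by
        gcongr
        calc ∫⁻ u in edgeAnnulus (2 * t),
              (Metric.closedBall z t).indicator (fun u => ‖z - u‖ₑ ^ (-p)) u
            ≤ ∫⁻ u, (Metric.closedBall z t).indicator (fun u => ‖z - u‖ₑ ^ (-p)) u :=
              setLIntegral_le_lintegral _ _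
          _ ≤ ∫⁻ u, (Metric.ball (0 : ℂ) 1).indicator (fun v => ‖v‖ₑ ^ (-p)) (z - u) := by
              refine lintegral_mono fun u => ?_
              by_cases hu2 : u ∈ Metric.closedBall z t
              · have : z - u ∈ Metric.ball (0 : ℂ) 1 := by
                  rw [Metric.mem_closedBall, dist_eq_norm, norm_sub_rev] at hu2
                  rw [mem_ball_zero_iff]
                  linarith
                rw [Set.indicator_of_mem hu2, Set.indicator_of_mem this]
              · rw [Set.indicator_of_notMem hu2]
                exact zero_le
          _ = ∫⁻ v, (Metric.ball (0 : ℂ) 1).indicator (fun v => ‖v‖ₑ ^ (-p)) v :=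
              lintegral_sub_left_eq_self _ z
          _ = N := lintegral_indicator measurableSet_ball _
    _ ≤ ENNReal.ofReal (K * (2 * t) ^ α) * ENNReal.ofReal (N.toReal + 1) := by
        gcongr
        rw [← ENNReal.ofReal_toReal hNt.ne]
        exact ENNReal.ofReal_le_ofReal (by simp)
    _ = _ := by
        rw [← ENNReal.ofReal_mul (by positivity), Real.mul_rpow (by norm_num) ht.le]
        congr 1
        ring

/-- Beyond distance `ε/2` the kernel is bounded. Applied with `p = 1` to the variance of the field
and with `p = 3/2` to its mean. -/
theorem EdgeRegular.exists_lintegral_le [IsProbabilityMeasure μ] (h : EdgeRegular μ α ε k K)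
    {p : ℝ} (hp0 : 0 < p) (hp : p < 2) : ∃ L : ℝ, 0 < L ∧ ∀ z : ℂ, 1 - ε / 2 ≤ ‖z‖ →
      ∫⁻ u, ‖z - u‖ₑ ^ (-p) ∂μ ≤ ENNReal.ofReal L := by
  obtain ⟨L, hL, hb⟩ := h.exists_setLIntegral_le hp
  have hε := h.eps_pos
  refine ⟨L * (ε / 2) ^ α + (ε / 2) ^ (-p), by positivity, fun z hz => ?_⟩
  rw [← lintegral_add_compl _ (measurableSet_closedBall (x := z) (ε := ε / 2)),
    ENNReal.ofReal_add (by positivity) (by positivity)]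
  refine add_le_add (hb _ (by positivity) (by linarith) z hz) ?_
  calc ∫⁻ u in (Metric.closedBall z (ε / 2))ᶜ, ‖z - u‖ₑ ^ (-p) ∂μ
      ≤ ∫⁻ u in (Metric.closedBall z (ε / 2))ᶜ, ENNReal.ofReal ((ε / 2) ^ (-p)) ∂μ := by
        refine setLIntegral_mono' measurableSet_closedBall.compl fun u hu => ?_
        rw [Set.mem_compl_iff, Metric.mem_closedBall, dist_eq_norm, norm_sub_rev, not_le] at hu
        rw [← ofReal_norm, ENNReal.ofReal_rpow_of_pos (by linarith)]
        exact ENNReal.ofReal_le_ofReal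
          (Real.rpow_le_rpow_of_nonpos (by positivity) hu.le (by linarith))
    _ ≤ _ := by
        rw [setLIntegral_const]
        exact mul_le_of_le_one_right' prob_le_one

/-- The kernel `1 / v`, cut off near the origin. -/
noncomputable def cutoffInv (ρ : ℝ) (v : ℂ) : ℂ := if ρ ≤ ‖v‖ then 1 / v else 0

theorem measurable_cutoffInv (ρ : ℝ) : Measurable (cutoffInv ρ) := by
  unfold cutoffInv
  refine Measurable.ite (measurableSet_le measurable_const measurable_norm) ?_ measurable_const
  fun_prop

theorem norm_cutoffInv_le {ρ : ℝ} (hρ : 0 < ρ) (v : ℂ) : ‖cutoffInv ρ v‖ ≤ 1 / ρ := by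
  unfold cutoffInv
  split_ifs with h
  · rw [norm_div, norm_one]
    exact one_div_le_one_div_of_le hρ h
  · simp [hρ.le]

theorem enorm_cutoffInv_le (ρ : ℝ) (v : ℂ) : ‖cutoffInv ρ v‖ₑ ≤ ‖v‖ₑ ^ (-1 : ℝ) := by
  unfold cutoffInv
  rw [ENNReal.rpow_neg_one]
  split_ifs with h
  · by_cases hv : v = 0
    · simp [hv]
    · rw [one_div, enorm_inv hv]
  · simp

theorem integrable_cutoffInv [IsFiniteMeasure μ] {ρ : ℝ} (hρ : 0 < ρ) (z : ℂ) :
    Integrable (fun u => cutoffInv ρ (z - u)) μ :=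
  Integrable.of_bound ((measurable_cutoffInv ρ).comp (by fun_prop)).aestronglyMeasurable (1 / ρ)
    (ae_of_all _ fun _ => norm_cutoffInv_le hρ _)

/-- What matters is that `L` does not depend on the cut-off `ρ`: together with the sup bound `1/ρ`
it gives a second moment `L/ρ` instead of `1/ρ^2`. -/
theorem EdgeRegular.exists_integral_norm_cutoffInv_le [IsProbabilityMeasure μ]
    (h : EdgeRegular μ α ε k K) : ∃ L : ℝ, 0 < L ∧ ∀ z : ℂ, 1 - ε / 2 ≤ ‖z‖ → ∀ ρ : ℝ, 0 < ρ →
      ∫ u, ‖cutoffInv ρ (z - u)‖ ∂μ ≤ L := by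
  obtain ⟨L, hL, hb⟩ := h.exists_lintegral_le (p := 1) one_pos (by norm_num)
  refine ⟨L, hL, fun z hz ρ hρ => ?_⟩
  rw [integral_norm_eq_lintegral_enorm (integrable_cutoffInv hρ z).1]
  refine ENNReal.toReal_le_of_le_ofReal hL.le ((lintegral_mono fun u => ?_).trans (hb z hz))
  exact enorm_cutoffInv_le _ _

/-- Mean value property: a radial measure has the Cauchy transform of a point mass at `0`. -/
theorem EdgeRegular.setIntegral_one_div_sub [IsProbabilityMeasure μ] (h : EdgeRegular μ α ε k K)
    {r : ℝ} {z : ℂ} (hz : r < ‖z‖) :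
    ∫ u in Metric.ball (0 : ℂ) r, 1 / (z - u) ∂μ = μ.real (Metric.ball 0 r) / z := by
  by_cases hr : 0 < r
  swap
  · rw [Metric.ball_eq_empty.2 (not_lt.1 hr)]
    simp
  have hpi := Real.pi_pos
  set B := Metric.ball (0 : ℂ) r with hB
  have hBm : MeasurableSet B := measurableSet_ball
  set F : ℂ → ℂ := B.indicator fun u => 1 / (z - u) with hF
  have hFm : Measurable F := (by fun_prop : Measurable fun u : ℂ => 1 / (z - u)).indicator hBm
  have hFb : ∀ u, ‖F u‖ ≤ 1 / (‖z‖ - r) := by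
    intro u
    by_cases hu : u ∈ B
    · rw [hF, Set.indicator_of_mem hu, norm_div, norm_one]
      rw [hB, mem_ball_zero_iff] at hu
      exact one_div_le_one_div_of_le (by linarith) (by linarith [norm_sub_norm_le z u])
    · rw [hF, Set.indicator_of_notMem hu, norm_zero]
      exact one_div_nonneg.2 (by linarith)
  have hrot : ∀ t : ℝ, ∫ u, F (Complex.exp (t * Complex.I) * u) ∂μ = ∫ u, F u ∂μ := by
    intro t
    conv_rhs => rw [← h.rotation_invariant t]
    rw [integral_map (by fun_prop) hFm.aestronglyMeasurable]
  -- For `|u| < r < |z|` the function `w ↦ 1 / (z - w u)` is holomorphic across the closed unit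
  -- disk, so its circle average is its value `1/z` at `0`. Integrating over `u`, exchanging the
  -- integrals and using invariance under each rotation gives the claim.
  have hcirc : ∀ u, ∫ t in (0 : ℝ)..(2 * Real.pi), F (Complex.exp (t * Complex.I) * u) =
      B.indicator (fun _ => 2 * Real.pi / z) u := by
    intro u
    have hmem : ∀ t : ℝ, Complex.exp (t * Complex.I) * u ∈ B ↔ u ∈ B := by
      intro t
      simp [hB, Complex.norm_exp_ofReal_mul_I]
    by_cases hu : u ∈ B
    · rw [Set.indicator_of_mem hu]
      have hd : DiffContOnCl ℂ (fun w : ℂ => 1 / (z - w * u)) (Metric.ball 0 |1|) := by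
        refine DifferentiableOn.diffContOnCl fun w hw => ?_
        rw [abs_one, closure_ball _ one_ne_zero, mem_closedBall_zero_iff] at hw
        rw [hB, mem_ball_zero_iff] at hu
        have hne : z - w * u ≠ 0 := by
          rw [← norm_pos_iff]
          have := norm_sub_norm_le z (w * u)
          rw [norm_mul] at this
          nlinarith [norm_nonneg u]
        refine DifferentiableAt.differentiableWithinAt ?_
        exact (differentiableAt_const _).div (by fun_prop) hne
      have h1 := hd.circleAverage
      rw [Real.circleAverage_def] at h1
      have h2 : (∫ t in (0 : ℝ)..(2 * Real.pi), F (Complex.exp (t * Complex.I) * u)) =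
          ∫ t in (0 : ℝ)..(2 * Real.pi), 1 / (z - circleMap 0 1 t * u) := by
        refine intervalIntegral.integral_congr fun t _ => ?_
        simp only [hF]
        rw [Set.indicator_of_mem ((hmem t).2 hu)]
        simp [circleMap]
      rw [h2]
      rw [inv_smul_eq_iff₀ (by positivity)] at h1
      rw [h1, Complex.real_smul]
      push_cast
      ring
    · rw [Set.indicator_of_notMem hu]
      simp only [hF, Set.indicator_of_notMem (mt (hmem _).1 hu)]
      simp
  have hint : Integrable (Function.uncurry fun (t : ℝ) (u : ℂ) =>
      F (Complex.exp (t * Complex.I) * u))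
      ((volume.restrict (Set.uIoc 0 (2 * Real.pi))).prod μ) := by
    have : IsFiniteMeasure (volume.restrict (Set.uIoc 0 (2 * Real.pi))) := by
      rw [Set.uIoc_of_le (by positivity)]; infer_instance
    refine Integrable.of_bound ?_ (1 / (‖z‖ - r)) (ae_of_all _ fun _ => hFb _)
    exact (hFm.comp (by fun_prop)).aestronglyMeasurable
  have hswap := intervalIntegral_integral_swap hint
  simp only [hrot, hcirc] at hswap
  rw [intervalIntegral.integral_const, integral_indicator hBm, integral_indicator hBm,
    setIntegral_const, sub_zero] at hswap
  simp only [Complex.real_smul] at hswap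
  have h2pi : (Real.pi : ℂ) ≠ 0 := by exact_mod_cast hpi.ne'
  have hz0 : z ≠ 0 := norm_pos_iff.1 (hr.trans hz)
  push_cast at hswap
  field_simp at hswap ⊢
  linear_combination hswap

end Kernel

/-! ### The mean field near the edge. -/

section Mean

variable {μ : Measure ℂ} {α ε k K : ℝ}

/-- For `|v| ≤ σ` one has `1/|v| ≤ σ^(1/2) |v|^(-3/2)`; otherwise `1/|v| ≤ 1/σ`. The first term has
a small integral because of its coefficient, the second on sets of small mass. -/
theorem enorm_cutoffInv_le_add {σ : ℝ} (hσ : 0 < σ) (ρ : ℝ) (v : ℂ) :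
    ‖cutoffInv ρ v‖ₑ ≤ ENNReal.ofReal (σ ^ (1 / 2 : ℝ)) * ‖v‖ₑ ^ (-(3 / 2) : ℝ) +
      ENNReal.ofReal (1 / σ) := by
  by_cases hv : v = 0
  · simp [cutoffInv, hv]
  refine (enorm_cutoffInv_le ρ v).trans ?_
  have hx : 0 < ‖v‖ := norm_pos_iff.2 hv
  rw [← ofReal_norm, ENNReal.ofReal_rpow_of_pos hx, ENNReal.ofReal_rpow_of_pos hx,
    ← ENNReal.ofReal_mul (by positivity), ← ENNReal.ofReal_add (by positivity) (by positivity)]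
  refine ENNReal.ofReal_le_ofReal ?_
  rw [Real.rpow_neg_one]
  rcases le_total σ ‖v‖ with h | h
  · have : ‖v‖⁻¹ ≤ 1 / σ := by rw [one_div]; exact inv_anti₀ hσ h
    have : 0 ≤ σ ^ (1 / 2 : ℝ) * ‖v‖ ^ (-(3 / 2) : ℝ) := by positivity
    linarith
  · have h1 : ‖v‖⁻¹ = ‖v‖ ^ (1 / 2 : ℝ) * ‖v‖ ^ (-(3 / 2) : ℝ) := by
      rw [← Real.rpow_add hx, ← Real.rpow_neg_one]
      norm_num
    have h2 : ‖v‖ ^ (1 / 2 : ℝ) ≤ σ ^ (1 / 2 : ℝ) := Real.rpow_le_rpow hx.le h (by norm_num)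
    have h3 : ‖v‖ ^ (1 / 2 : ℝ) * ‖v‖ ^ (-(3 / 2) : ℝ) ≤
      σ ^ (1 / 2 : ℝ) * ‖v‖ ^ (-(3 / 2) : ℝ) := by gcongr
    have : 0 ≤ 1 / σ := by positivity
    linarith

theorem EdgeRegular.measure_compl_ball_le (h : EdgeRegular μ α ε k K) {t : ℝ} (ht : 0 < t)
    (htε : t ≤ ε) : μ (Metric.ball 0 (1 - t))ᶜ ≤ ENNReal.ofReal (2 * Real.pi * K * t) := by
  calc μ (Metric.ball 0 (1 - t))ᶜ ≤ μ (edgeAnnulus t) := by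
        refine measure_mono_ae ?_
        filter_upwards [h.supported] with u hu hu2
        have hu3 : ¬ (‖u‖ < 1 - t) := fun h => hu2 (mem_ball_zero_iff.2 h)
        exact ⟨not_lt.1 hu3, hu⟩
    _ ≤ ENNReal.ofReal (2 * Real.pi * K * t ^ (α + 1)) := h.measure_edgeAnnulus_le ht htε
    _ ≤ _ := by
        have hK := h.upper_pos
        refine ENNReal.ofReal_le_ofReal (mul_le_mul_of_nonneg_left ?_ (by positivity))
        have h1 := Real.rpow_le_rpow_of_exponent_ge ht (by linarith [h.eps_le])
          (show (1 : ℝ) ≤ α + 1 by linarith [h.nonneg])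
        simpa using h1

/-- Near the edge, the cut-off Cauchy transform of `μ` is close to `1 / z`. -/
theorem EdgeRegular.exists_norm_integral_cutoffInv_sub_le [IsProbabilityMeasure μ]
    (h : EdgeRegular μ α ε k K) : ∃ L : ℝ, 0 < L ∧ ∀ t : ℝ, 0 < t → 8 * t ≤ ε → ∀ ρ : ℝ,
      0 < ρ → ρ ≤ t → ∀ z : ℂ, 1 - 3 * t ≤ ‖z‖ →
      ‖∫ u, cutoffInv ρ (z - u) ∂μ - 1 / z‖ ≤ L * t ^ (1 / 4 : ℝ) := by
  obtain ⟨L, hL, hb⟩ := h.exists_lintegral_le (p := 3 / 2) (by norm_num) (by norm_num)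
  have hK := h.upper_pos
  have hε := h.eps_le
  have hpi := Real.pi_pos
  refine ⟨L + 24 * Real.pi * K, by positivity, fun t ht htε ρ hρ hρt z hz => ?_⟩
  -- As `|z| ≥ 1 - 3t`, points of `B` are at distance at least `t ≥ ρ` from `z`: the cut-off is
  -- inactive on `B` and the Cauchy transform there is exact.
  set B := Metric.ball (0 : ℂ) (1 - 4 * t) with hB
  have hBm : MeasurableSet B := measurableSet_ball
  have hBc : μ Bᶜ ≤ ENNReal.ofReal (8 * Real.pi * K * t) := by
    have := h.measure_compl_ball_le (t := 4 * t) (by linarith) (by linarith)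
    convert this using 2
    ring
  have hBr : μ.real Bᶜ ≤ 8 * Real.pi * K * t :=
    ENNReal.toReal_le_of_le_ofReal (by positivity) hBc
  have hz2 : 1 / 2 ≤ ‖z‖ := by linarith
  have hz0 : z ≠ 0 := norm_pos_iff.1 (by linarith)
  have ht1 : t ≤ 1 := by linarith
  have hin : ∫ u in B, cutoffInv ρ (z - u) ∂μ = μ.real B / z := by
    rw [← h.setIntegral_one_div_sub (show 1 - 4 * t < ‖z‖ by linarith)]
    refine setIntegral_congr_fun hBm fun u hu => ?_
    rw [hB, mem_ball_zero_iff] at hu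
    have : ρ ≤ ‖z - u‖ := by linarith [norm_sub_norm_le z u]
    simp [cutoffInv, this]
  have hout : ‖∫ u in Bᶜ, cutoffInv ρ (z - u) ∂μ‖ ≤
      (L + 8 * Real.pi * K) * t ^ (1 / 4 : ℝ) := by
    refine (norm_integral_le_integral_norm _).trans ?_
    rw [integral_norm_eq_lintegral_enorm (integrable_cutoffInv hρ z).1.restrict]
    refine ENNReal.toReal_le_of_le_ofReal (by positivity) ?_
    -- With the mass of the complement being `O(t)`, the two terms become `σ^(1/2) = t^(1/4)` and
    -- `t/σ = t^(1/2)`.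
    set σ : ℝ := t ^ (1 / 2 : ℝ) with hσ
    have hσ0 : 0 < σ := Real.rpow_pos_of_pos ht _
    calc ∫⁻ u in Bᶜ, ‖cutoffInv ρ (z - u)‖ₑ ∂μ
        ≤ ∫⁻ u in Bᶜ, (ENNReal.ofReal (σ ^ (1 / 2 : ℝ)) * ‖z - u‖ₑ ^ (-(3 / 2) : ℝ) +
            ENNReal.ofReal (1 / σ)) ∂μ := lintegral_mono fun u => enorm_cutoffInv_le_add hσ0 ρ _
      _ = ENNReal.ofReal (σ ^ (1 / 2 : ℝ)) * ∫⁻ u in Bᶜ, ‖z - u‖ₑ ^ (-(3 / 2) : ℝ) ∂μ +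
            ENNReal.ofReal (1 / σ) * μ Bᶜ := by
          rw [lintegral_add_right _ measurable_const,
            lintegral_const_mul _ (measurable_enorm_sub_rpow z _), setLIntegral_const]
      _ ≤ ENNReal.ofReal (σ ^ (1 / 2 : ℝ)) * ENNReal.ofReal L +
            ENNReal.ofReal (1 / σ) * ENNReal.ofReal (8 * Real.pi * K * t) := by
          gcongr
          exact (setLIntegral_le_lintegral _ _).trans (hb z (by linarith))
      _ = ENNReal.ofReal (t ^ (1 / 4 : ℝ) * L + 8 * Real.pi * K * t ^ (1 / 2 : ℝ)) := by
          rw [← ENNReal.ofReal_mul (by positivity), ← ENNReal.ofReal_mul (by positivity),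
            ← ENNReal.ofReal_add (by positivity) (by positivity)]
          congr 2
          · rw [hσ, ← Real.rpow_mul ht.le]; norm_num
          · have : t = σ * σ := by rw [hσ, ← Real.rpow_add ht]; norm_num
            rw [← hσ]
            conv_lhs => rw [this]
            field_simp
      _ ≤ _ := by
          refine ENNReal.ofReal_le_ofReal ?_
          have : t ^ (1 / 2 : ℝ) ≤ t ^ (1 / 4 : ℝ) :=
            Real.rpow_le_rpow_of_exponent_ge ht ht1 (by norm_num)
          have : 8 * Real.pi * K * t ^ (1 / 2 : ℝ) ≤ 8 * Real.pi * K * t ^ (1 / 4 : ℝ) := by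
            gcongr
          linarith
  have hmain : ‖(μ.real B : ℂ) / z - 1 / z‖ ≤ 16 * Real.pi * K * t ^ (1 / 4 : ℝ) := by
    have h1 : μ.real B = 1 - μ.real Bᶜ := by
      rw [probReal_compl_eq_one_sub hBm]; ring
    have h2 : (μ.real B : ℂ) / z - 1 / z = -((μ.real Bᶜ : ℂ) / z) := by
      rw [h1]; push_cast; ring
    rw [h2, norm_neg, norm_div, Complex.norm_real, Real.norm_of_nonneg measureReal_nonneg,
      div_le_iff₀ (by linarith)]
    have h3 : t ≤ t ^ (1 / 4 : ℝ) := by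
      simpa using Real.rpow_le_rpow_of_exponent_ge ht ht1 (show (1 / 4 : ℝ) ≤ 1 by norm_num)
    have h4 : 8 * Real.pi * K * t ≤ 8 * Real.pi * K * t ^ (1 / 4 : ℝ) := by gcongr
    have h5 : 0 ≤ 8 * Real.pi * K * t ^ (1 / 4 : ℝ) := by positivity
    nlinarith
  rw [← integral_add_compl hBm (integrable_cutoffInv hρ z), hin]
  calc ‖(μ.real B : ℂ) / z + ∫ u in Bᶜ, cutoffInv ρ (z - u) ∂μ - 1 / z‖
      = ‖((μ.real B : ℂ) / z - 1 / z) + ∫ u in Bᶜ, cutoffInv ρ (z - u) ∂μ‖ := by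
        congr 1; ring
    _ ≤ _ := (norm_add_le _ _).trans (add_le_add hmain hout)
    _ = _ := by ring

end Mean

/-! ### Chernoff and Markov bounds for i.i.d. sums. -/

section Concentration

variable {Ω E : Type*} [MeasurableSpace Ω] [MeasurableSpace E] {P : Measure Ω}
  [IsProbabilityMeasure P] {μ : Measure E} [IsProbabilityMeasure μ] {X : ℕ → Ω → E}

/-- Bernstein's argument: `e^y ≤ 1 + y + y^2` for `|y| ≤ 1`, integrated, followed by `1 + y ≤ e^y`.
Keeping the second moment `v` rather than `b^2` is essential for kernels with a large sup norm. -/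
theorem mgf_comp_le {Y : Ω → E} (hY : Measurable Y) (hlaw : P.map Y = μ) {φ : E → ℝ}
    (hφ : Measurable φ) {b v l : ℝ} (hb : ∀ u, |φ u| ≤ b) (hv : ∫ u, φ u ^ 2 ∂μ ≤ v)
    (hl : 0 ≤ l) (hlb : l * b ≤ 1) :
    mgf (fun ω => φ (Y ω)) P l ≤ Real.exp (l * ∫ u, φ u ∂μ + l ^ 2 * v) := by
  have hint : Integrable φ μ := Integrable.of_bound hφ.aestronglyMeasurable b (ae_of_all _ hb)
  have hint2 : Integrable (fun u => φ u ^ 2) μ :=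
    Integrable.of_bound (by fun_prop) (b ^ 2) (ae_of_all _ fun u => by
      rw [Real.norm_eq_abs, abs_pow]
      exact pow_le_pow_left₀ (abs_nonneg _) (hb u) 2)
  have hint1 : Integrable (fun u => 1 + l * φ u) μ := (integrable_const _).add (hint.const_mul l)
  have habs : ∀ u, |l * φ u| ≤ 1 := fun u => by
    rw [abs_mul, abs_of_nonneg hl]
    exact (mul_le_mul_of_nonneg_left (hb u) hl).trans hlb
  calc mgf (fun ω => φ (Y ω)) P l = ∫ u, Real.exp (l * φ u) ∂μ := by
        rw [mgf, ← hlaw, integral_map hY.aemeasurable (by fun_prop)]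
    _ ≤ ∫ u, (1 + l * φ u + l ^ 2 * φ u ^ 2) ∂μ := by
        refine integral_mono (Integrable.of_bound (by fun_prop) (Real.exp 1)
          (ae_of_all _ fun u => ?_)) (hint1.add (hint2.const_mul _)) fun u => ?_
        · rw [Real.norm_of_nonneg (Real.exp_pos _).le]
          exact Real.exp_le_exp.2 ((le_abs_self _).trans (habs u))
        · have := (abs_le.1 (Real.abs_exp_sub_one_sub_id_le (habs u))).2
          simp only
          nlinarith
    _ = 1 + l * ∫ u, φ u ∂μ + l ^ 2 * ∫ u, φ u ^ 2 ∂μ := by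
        rw [integral_add hint1 (hint2.const_mul _),
          integral_add (integrable_const _) (hint.const_mul l), integral_const_mul,
          integral_const_mul]
        simp
    _ ≤ 1 + (l * ∫ u, φ u ∂μ + l ^ 2 * v) := by
        have : l ^ 2 * ∫ u, φ u ^ 2 ∂μ ≤ l ^ 2 * v := by gcongr
        linarith
    _ ≤ _ := by linarith [Real.add_one_le_exp (l * ∫ u, φ u ∂μ + l ^ 2 * v)]

/-- Chernoff's bound for sums of bounded functions of i.i.d. variables. -/
theorem measure_sum_ge_le (hXmeas : ∀ i, Measurable (X i)) (hXindep : iIndepFun X P)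
    (hXlaw : ∀ i, P.map (X i) = μ) (n : ℕ) {φ : E → ℝ} (hφ : Measurable φ) {b v l : ℝ}
    (hb : ∀ u, |φ u| ≤ b) (hv : ∫ u, φ u ^ 2 ∂μ ≤ v) (hl : 0 ≤ l) (hlb : l * b ≤ 1) (t : ℝ) :
    P.real {ω | n * ∫ u, φ u ∂μ + t ≤ ∑ i : Fin n, φ (X i ω)} ≤
      Real.exp (-(l * t) + n * (l ^ 2 * v)) := by
  have hind : iIndepFun (fun (i : Fin n) ω => φ (X i ω)) P :=
    (hXindep.precomp Fin.val_injective).comp (fun _ => φ) fun _ => hφ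
  have hm : ∀ i : Fin n, Measurable fun ω => φ (X i ω) := fun i => hφ.comp (hXmeas i)
  have hsum : (fun ω => ∑ i : Fin n, φ (X i ω)) = ∑ i : Fin n, fun ω => φ (X i ω) := by
    ext ω; simp
  have hbd : ∀ ω, |∑ i : Fin n, φ (X i ω)| ≤ n * b := fun ω => by
    refine (Finset.abs_sum_le_sum_abs _ _).trans ?_
    refine (Finset.sum_le_card_nsmul _ _ b fun i _ => hb _).trans (by simp)
  have hint : Integrable (fun ω => Real.exp (l * ∑ i : Fin n, φ (X i ω))) P := by
    refine Integrable.of_bound ?_ (Real.exp (l * (n * b))) (ae_of_all _ fun ω => ?_)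
    · exact (Real.measurable_exp.comp
        ((Finset.measurable_fun_sum _ fun i _ => hm i).const_mul l)).aestronglyMeasurable
    · rw [Real.norm_of_nonneg (Real.exp_pos _).le]
      exact Real.exp_le_exp.2
        (mul_le_mul_of_nonneg_left ((le_abs_self _).trans (hbd ω)) hl)
  refine (measure_ge_le_exp_mul_mgf _ hl hint).trans ?_
  rw [hsum, hind.mgf_sum hm]
  calc Real.exp (-l * (n * ∫ u, φ u ∂μ + t)) * ∏ i : Fin n, mgf (fun ω => φ (X i ω)) P l
      ≤ Real.exp (-l * (n * ∫ u, φ u ∂μ + t)) *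
          ∏ _i : Fin n, Real.exp (l * ∫ u, φ u ∂μ + l ^ 2 * v) := by
        gcongr with i
        · exact fun _ _ => mgf_nonneg
        · exact mgf_comp_le (hXmeas i) (hXlaw i) hφ hb hv hl hlb
    _ = _ := by
        rw [Finset.prod_const, Finset.card_univ, Fintype.card_fin, ← Real.exp_nat_mul,
          ← Real.exp_add]
        congr 1
        ring

/-- Since `|w| ≤ |re w| + |im w|`, a deviation above `s` forces one of `±re`, `±im` to deviate by at
least `s/2`; each has second moment at most `v`. -/
theorem measure_norm_sum_sub_le (hXmeas : ∀ i, Measurable (X i)) (hXindep : iIndepFun X P)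
    (hXlaw : ∀ i, P.map (X i) = μ) (n : ℕ) {φ : E → ℂ} (hφ : Measurable φ) {b v l : ℝ}
    (hb : ∀ u, ‖φ u‖ ≤ b) (hv : ∫ u, ‖φ u‖ ^ 2 ∂μ ≤ v) (hl : 0 ≤ l) (hlb : l * b ≤ 1)
    (s : ℝ) :
    P.real {ω | s < ‖∑ i : Fin n, φ (X i ω) - n * ∫ u, φ u ∂μ‖} ≤
      4 * Real.exp (-(l * (s / 2)) + n * (l ^ 2 * v)) := by
  have hint : Integrable φ μ := Integrable.of_bound hφ.aestronglyMeasurable b (ae_of_all _ hb)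
  have hint2 : Integrable (fun u => ‖φ u‖ ^ 2) μ :=
    Integrable.of_bound (by fun_prop) (b ^ 2) (ae_of_all _ fun u => by
      rw [norm_pow, norm_norm]
      exact pow_le_pow_left₀ (norm_nonneg _) (hb u) 2)
  have key : ∀ ψ : E → ℝ, Measurable ψ → (∀ u, |ψ u| ≤ ‖φ u‖) →
      P.real {ω | n * ∫ u, ψ u ∂μ + s / 2 ≤ ∑ i : Fin n, ψ (X i ω)} ≤
        Real.exp (-(l * (s / 2)) + n * (l ^ 2 * v)) := by
    intro ψ hψ hψφ
    refine measure_sum_ge_le hXmeas hXindep hXlaw n hψ (fun u => (hψφ u).trans (hb u)) ?_ hl hlb _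
    refine (integral_mono_of_nonneg (ae_of_all _ fun u => sq_nonneg _) hint2
      (ae_of_all _ fun u => ?_)).trans hv
    simp only
    rw [← sq_abs]
    exact pow_le_pow_left₀ (abs_nonneg _) (hψφ u) 2
  have hre : ∫ u, (φ u).re ∂μ = (∫ u, φ u ∂μ).re := integral_re hint
  have him : ∫ u, (φ u).im ∂μ = (∫ u, φ u ∂μ).im := integral_im hint
  have k1 := key (fun u => (φ u).re) (by fun_prop) fun u => Complex.abs_re_le_norm _
  have k2 := key (fun u => -(φ u).re) (by fun_prop) fun u => by
    rw [abs_neg]; exact Complex.abs_re_le_norm _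
  have k3 := key (fun u => (φ u).im) (by fun_prop) fun u => Complex.abs_im_le_norm _
  have k4 := key (fun u => -(φ u).im) (by fun_prop) fun u => by
    rw [abs_neg]; exact Complex.abs_im_le_norm _
  rw [integral_neg] at k2 k4
  rw [hre] at k1 k2
  rw [him] at k3 k4
  set A1 := {ω | n * (∫ u, φ u ∂μ).re + s / 2 ≤ ∑ i : Fin n, (φ (X i ω)).re}
  set A2 := {ω | n * -(∫ u, φ u ∂μ).re + s / 2 ≤ ∑ i : Fin n, -(φ (X i ω)).re}
  set A3 := {ω | n * (∫ u, φ u ∂μ).im + s / 2 ≤ ∑ i : Fin n, (φ (X i ω)).im}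
  set A4 := {ω | n * -(∫ u, φ u ∂μ).im + s / 2 ≤ ∑ i : Fin n, -(φ (X i ω)).im}
  have hsub : {ω | s < ‖∑ i : Fin n, φ (X i ω) - n * ∫ u, φ u ∂μ‖} ⊆ (A1 ∪ A2) ∪ (A3 ∪ A4) := by
    intro ω hω
    by_contra hno
    simp only [Set.mem_union, not_or, A1, A2, A3, A4, Set.mem_ofPred_eq, not_le,
      Finset.sum_neg_distrib] at hno
    obtain ⟨⟨h1, h2⟩, h3, h4⟩ := hno
    have h5 := Complex.norm_le_abs_re_add_abs_im (∑ i : Fin n, φ (X i ω) - n * ∫ u, φ u ∂μ)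
    simp only [Complex.sub_re, Complex.sub_im, Complex.re_sum, Complex.im_sum, Complex.mul_re,
      Complex.mul_im, Complex.natCast_re, Complex.natCast_im, zero_mul, sub_zero, add_zero] at h5
    have h6 : |∑ i : Fin n, (φ (X i ω)).re - n * (∫ u, φ u ∂μ).re| < s / 2 :=
      abs_lt.2 ⟨by linarith, by linarith⟩
    have h7 : |∑ i : Fin n, (φ (X i ω)).im - n * (∫ u, φ u ∂μ).im| < s / 2 :=
      abs_lt.2 ⟨by linarith, by linarith⟩
    have h8 : s < ‖∑ i : Fin n, φ (X i ω) - n * ∫ u, φ u ∂μ‖ := hω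
    linarith
  calc _ ≤ P.real ((A1 ∪ A2) ∪ (A3 ∪ A4)) := measureReal_mono hsub
    _ ≤ (P.real A1 + P.real A2) + (P.real A3 + P.real A4) :=
        (measureReal_union_le _ _).trans
          (add_le_add (measureReal_union_le _ _) (measureReal_union_le _ _))
    _ ≤ _ := by linarith

/-- Markov's inequality for sums over pairs of i.i.d. variables. -/
theorem measure_sum_pairs_ge_le (hXmeas : ∀ i, Measurable (X i)) (hXindep : iIndepFun X P)
    (hXlaw : ∀ i, P.map (X i) = μ) (n : ℕ) {Φ : E × E → ENNReal} (hΦ : Measurable Φ) {A Q : ℝ}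
    (hA0 : 0 ≤ A) (hA : ∫⁻ u, ∫⁻ w, Φ (u, w) ∂μ ∂μ ≤ ENNReal.ofReal A) (hQ : 0 < Q) :
    P.real {ω | ENNReal.ofReal Q ≤
      ∑ i : Fin n, ∑ j ∈ Finset.univ.erase i, Φ (X i ω, X j ω)} ≤ n ^ 2 * A / Q := by
  have hm : ∀ i j : Fin n, Measurable fun ω => Φ (X i ω, X j ω) := fun i j =>
    hΦ.comp ((hXmeas i).prodMk (hXmeas j))
  have h1 : ∀ i : Fin n, ∀ j ∈ Finset.univ.erase i,
      ∫⁻ ω, Φ (X i ω, X j ω) ∂P ≤ ENNReal.ofReal A := by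
    intro i j hj
    have hij : (i : ℕ) ≠ j := fun h => Finset.ne_of_mem_erase hj (Fin.val_injective h.symm)
    have h2 := (indepFun_iff_map_prod_eq_prod_map_map (hXmeas i).aemeasurable
      (hXmeas j).aemeasurable).1 (hXindep.indepFun hij)
    rw [hXlaw, hXlaw] at h2
    calc ∫⁻ ω, Φ (X i ω, X j ω) ∂P = ∫⁻ q, Φ q ∂(P.map fun ω => (X i ω, X j ω)) :=
          (lintegral_map hΦ ((hXmeas i).prodMk (hXmeas j))).symm
      _ = ∫⁻ u, ∫⁻ w, Φ (u, w) ∂μ ∂μ := by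
          rw [h2, lintegral_prod _ hΦ.aemeasurable]
      _ ≤ _ := hA
  have h3 : ∫⁻ ω, ∑ i : Fin n, ∑ j ∈ Finset.univ.erase i, Φ (X i ω, X j ω) ∂P ≤
      ENNReal.ofReal (n ^ 2 * A) := by
    rw [lintegral_finsetSum _ fun i _ => Finset.measurable_fun_sum _ fun j _ => hm i j]
    calc ∑ i : Fin n, ∫⁻ ω, ∑ j ∈ Finset.univ.erase i, Φ (X i ω, X j ω) ∂P
        ≤ ∑ _i : Fin n, ∑ _j : Fin n, ENNReal.ofReal A := by
          refine Finset.sum_le_sum fun i _ => ?_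
          rw [lintegral_finsetSum _ fun j _ => hm i j]
          exact (Finset.sum_le_sum (h1 i)).trans
            (Finset.sum_le_sum_of_subset (Finset.erase_subset _ _))
      _ = ENNReal.ofReal (n ^ 2 * A) := by
          rw [ENNReal.ofReal_mul (by positivity), ENNReal.ofReal_pow (by positivity),
            ENNReal.ofReal_natCast]
          simp [sq, mul_assoc]
  have h4 := meas_ge_le_lintegral_div (μ := P)
    (f := fun ω => ∑ i : Fin n, ∑ j ∈ Finset.univ.erase i, Φ (X i ω, X j ω))
    (Finset.measurable_fun_sum _ fun i _ =>
      Finset.measurable_fun_sum _ fun j _ => hm i j).aemeasurable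
    (ε := ENNReal.ofReal Q) (by simpa using hQ) ENNReal.ofReal_ne_top
  refine ENNReal.toReal_le_of_le_ofReal (by positivity) (h4.trans ?_)
  rw [ENNReal.ofReal_div_of_pos hQ]
  gcongr

end Concentration

/-! ### From well spread configurations to the three conclusions. -/

section WellSpread

/-- The isolation radius `n ^ (-(5 + δ) / 6)`. -/
noncomputable def isolationRadius (n : ℕ) (δ : ℝ) : ℝ := (n : ℝ) ^ (-(5 + δ) / 6)

/-- Configurations whose points near the edge are separated and see the field `n / z`. -/
structure WellSpread {n : ℕ} (x : Fin n → ℂ) (δ S κ : ℝ) : Prop where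
  norm_le : ∀ j, ‖x j‖ ≤ 1
  -- Twice the target width, because the root attached to a critical point of the annulus is first
  -- known only to lie within `R ≤ n^(-δ)` of it.
  separated : ∀ i, 1 - 2 * (n : ℝ) ^ (-δ) ≤ ‖x i‖ →
    ∀ j ≠ i, 2 * isolationRadius n δ ≤ ‖x i - x j‖
  sum_le : ∀ i, 1 - 2 * (n : ℝ) ^ (-δ) ≤ ‖x i‖ →
    ∑ j ∈ Finset.univ.erase i, 1 / ‖x i - x j‖ ^ 2 ≤ S
  -- Allowing an arbitrary `s` covers two cases at once: `z` a root, with its own index left out,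
  -- and `z` far from all roots, with `s` everything.
  field : ∀ (z : ℂ) (s : Finset (Fin n)), 1 - 2 * (n : ℝ) ^ (-δ) ≤ ‖z‖ → ‖z‖ ≤ 1 →
    (∀ j ∈ s, isolationRadius n δ ≤ ‖z - x j‖) → (∀ j ∉ s, x j = z) →
    ‖reciprocalSum s x z - n / z‖ ≤ n * κ

/-- The size relations between `n`, `c_n` and the bound `S` that hold for large `n`. -/
structure EdgeScales (n : ℕ) (δ c S : ℝ) : Prop where
  two_le : 2 ≤ n
  le_c : 32 ≤ c
  width : (n : ℝ) ^ (-δ) ≤ 1 / 4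
  radius_lower : 4 / (n : ℝ) ≤ isolationRadius n δ
  radius_upper : isolationRadius n δ ≤ (n : ℝ) ^ (-δ)
  radius_mul_sum : 4 * isolationRadius n δ * S ≤ n / 4
  sum_le : 32 * S ≤ (n : ℝ) ^ 2
  sum_lt : 32 * S / (n : ℝ) ^ 3 + 2 / (n : ℝ) ^ 2 < 1 / (n : ℝ) ^ ((3 - δ) / 2)
  sum_lt_c : 16 * S / (n : ℝ) ^ 2 < 2 / c

variable {n : ℕ} {x : Fin n → ℂ} {δ c S : ℝ}

/-- The constant `10` is `2 · 4 + 2`: the field error is `κ = 4/c`, and the energy term is below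
`2/c`. -/
theorem WellSpread.exists_criticalPoint (h : WellSpread x δ S (4 / c)) (hs : EdgeScales n δ c S)
    {i : Fin n} (hi : 1 - 2 * (n : ℝ) ^ (-δ) ≤ ‖x i‖) :
    (n : ℝ) / 2 ≤ ‖reciprocalSum (Finset.univ.erase i) x (x i)‖ ∧
    ∃ w : ℂ, (derivative (rootPoly x)).IsRoot w ∧ ‖w - x i‖ ≤ 2 / n ∧
      (derivative (rootPoly x)).rootMultiplicity w = 1 ∧
      (∀ w' : ℂ, (derivative (rootPoly x)).IsRoot w' → ‖w' - x i‖ ≤ isolationRadius n δ →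
        w' = w) ∧
      ‖w - x i + 1 / reciprocalSum (Finset.univ.erase i) x (x i)‖ ≤ 32 * S / n ^ 3 ∧
      ‖w - x i * (1 - 1 / (n : ℂ))‖ < 10 / (n * c) := by
  have hn : (0 : ℝ) < n := by exact_mod_cast (by linarith [hs.two_le] : 0 < n)
  have hc : 0 < c := by linarith [hs.le_c]
  have hx0 : x i ≠ 0 := norm_pos_iff.1 (by linarith [hs.width])
  have hR : 0 < isolationRadius n δ := lt_of_lt_of_le (by positivity) hs.radius_lower
  have h2n : 2 / (n : ℝ) ≤ 4 / n := by gcongr; norm_num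
  have hκ : 4 / c ≤ 1 / 4 := by rw [div_le_div_iff₀ hc (by norm_num)]; linarith [hs.le_c]
  obtain ⟨hg, w, h1, h2, h3, h4, h5, h6⟩ := exists_criticalPoint_near (by exact_mod_cast hn)
    (h.norm_le i) hx0 (h.separated i hi) (h.sum_le i hi)
    (h.field (x i) _ hi (h.norm_le i)
      (fun j hj => by linarith [h.separated i hi j (Finset.ne_of_mem_erase hj)])
      (fun j hj => by simp at hj; rw [hj]))
    hκ (h2n.trans hs.radius_lower) hs.radius_mul_sum hs.sum_le
  refine ⟨hg, w, h1, h2, h3, h4, h5, h6.trans_lt ?_⟩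
  have : 10 / (n * c) = (2 * (4 / c) + 2 / c) / n := by field_simp; norm_num
  rw [this]
  exact div_lt_div_of_pos_right (by linarith [hs.sum_lt_c]) hn

theorem WellSpread.rootsToCriticalPoints (h : WellSpread x δ S (4 / c))
    (hs : EdgeScales n δ c S) : RootsToCriticalPoints x δ c 10 := by
  intro i hi
  have hn : (0 : ℝ) < n := by exact_mod_cast (by linarith [hs.two_le] : 0 < n)
  have hR : 0 < isolationRadius n δ := lt_of_lt_of_le (by positivity) hs.radius_lower
  have hd : 0 < (n : ℝ) ^ (-δ) := by positivity
  have hi' : 1 - 2 * (n : ℝ) ^ (-δ) ≤ ‖x i‖ := by linarith [hi.1]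
  have hnc : (n : ℂ) ≠ 0 := by exact_mod_cast hn.ne'
  have hn1 : (n : ℂ) - 1 ≠ 0 := by
    rw [sub_ne_zero]
    exact_mod_cast (by linarith [hs.two_le] : n ≠ 1)
  obtain ⟨hg, w, h1, h2, h3, h4, h5, h6⟩ := h.exists_criticalPoint hs hi'
  set g := reciprocalSum (Finset.univ.erase i) x (x i) with hgdef
  have hg0 : g ≠ 0 := norm_pos_iff.1 (lt_of_lt_of_le (by positivity) hg)
  have hmf : meanField x i = 1 / ((n : ℂ) - 1) * g := rfl
  have h2n : 2 / (n : ℝ) ≤ 4 / n := by gcongr; norm_num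
  refine ⟨w, h1, h2.trans (h2n.trans hs.radius_lower), h3, h4, ?_, ?_, ?_, h6⟩
  · intro j hj hji
    have := h.separated i hi' j hj
    rw [hji, sub_self, norm_zero] at this
    linarith
  · rw [hmf]
    exact mul_ne_zero (one_div_ne_zero hn1) hg0
  -- The normalisation by `n - 1` makes `1 / meanField = (n - 1) / g`; the discrepancy `1 / (n g)`
  -- is at most `2/n^2`.
  · have e : w - x i + 1 / (n : ℂ) * (1 / meanField x i) =
        (w - x i + 1 / g) - 1 / n * (1 / g) := by
      rw [hmf]
      field_simp
      ring
    rw [e]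
    refine lt_of_le_of_lt ((norm_sub_le _ _).trans (add_le_add h5 ?_)) hs.sum_lt
    rw [norm_mul, norm_div, norm_div, norm_one, Complex.norm_natCast]
    calc 1 / (n : ℝ) * (1 / ‖g‖) ≤ 1 / n * (1 / (n / 2)) := by gcongr
      _ = 2 / (n : ℝ) ^ 2 := by field_simp

/-- Far from the roots the field differs from `n/w` by at most `4n/c < n`, while `|n/w| ≥ n`; so it
cannot vanish. -/
theorem WellSpread.exists_root_near (h : WellSpread x δ S (4 / c)) (hs : EdgeScales n δ c S)
    {w : ℂ} (hw : w ∈ edgeCriticalPoints x δ) : ∃ j, ‖w - x j‖ < isolationRadius n δ := by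
  by_contra! hfar
  have hn : (0 : ℝ) < n := by exact_mod_cast (by linarith [hs.two_le] : 0 < n)
  have hR : 0 < isolationRadius n δ := lt_of_lt_of_le (by positivity) hs.radius_lower
  have hc : 0 < c := by linarith [hs.le_c]
  have hd : 0 < (n : ℝ) ^ (-δ) := by positivity
  obtain ⟨hroot, hw1, hw2⟩ := hw
  have hwpos : 0 < ‖w‖ := by linarith [hs.width]
  refine not_isRoot_derivative_rootPoly (fun j hj => ?_) (fun h0 => ?_) hroot
  · have := hfar j
    rw [hj, sub_self, norm_zero] at this
    linarith
  · have h1 := h.field w Finset.univ (by linarith) hw2 (fun j _ => hfar j) (by simp)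
    rw [h0, zero_sub, norm_neg, norm_div, Complex.norm_natCast, div_le_iff₀ hwpos] at h1
    have hκ : 4 / c < 1 := by rw [div_lt_one hc]; linarith [hs.le_c]
    have h2 : (n : ℝ) * (4 / c) * ‖w‖ ≤ n * (4 / c) * 1 := by gcongr
    nlinarith

/-- Two critical points sharing a nearby root would contradict uniqueness in its disk. The bound `η
= 20/c` comes from dividing by `|x_i| ≥ 1/2`. -/
theorem WellSpread.criticalPointsToRoots (h : WellSpread x δ S (4 / c))
    (hs : EdgeScales n δ c S) : CriticalPointsToRoots x δ c 10 (20 / c) := by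
  have hn : (0 : ℝ) < n := by exact_mod_cast (by linarith [hs.two_le] : 0 < n)
  have hn2 : (2 : ℝ) ≤ n := by exact_mod_cast hs.two_le
  have hc : 0 < c := by linarith [hs.le_c]
  have hd : 0 < (n : ℝ) ^ (-δ) := by positivity
  have hnc : (n : ℂ) ≠ 0 := by exact_mod_cast hn.ne'
  choose ι hι using fun w : edgeCriticalPoints x δ => h.exists_root_near hs w.2
  have hedge : ∀ w, 1 - 2 * (n : ℝ) ^ (-δ) ≤ ‖x (ι w)‖ := by
    intro w
    have h1 := norm_sub_norm_le (w : ℂ) (x (ι w))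
    have h2 := w.2.2.1
    linarith [hι w, hs.radius_upper]
  refine ⟨ι, ?_, ?_⟩
  · intro w w' hww
    obtain ⟨-, v, -, -, -, huniq, -⟩ := h.exists_criticalPoint hs (hedge w)
    refine Subtype.ext ((huniq w w.2.1 (hι w).le).trans (huniq w' w'.2.1 ?_).symm)
    rw [hww]
    exact (hι w').le
  · intro w
    obtain ⟨-, v, -, -, -, huniq, -, hv⟩ := h.exists_criticalPoint hs (hedge w)
    rw [← huniq w w.2.1 (hι w).le] at hv
    have hhalf : 1 / 2 ≤ ‖x (ι w)‖ := by linarith [hedge w, hs.width]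
    have hx0 : x (ι w) ≠ 0 := norm_pos_iff.1 (by linarith)
    refine ⟨⟨?_, h.norm_le _⟩, ⟨(w - x (ι w) * (1 - 1 / (n : ℂ))) / x (ι w), ?_, ?_⟩, hv⟩
    -- The factor `1 - 1/n` moves inward by at least `1/(2n)`, more than the error `10/(nc)`. So the
    -- root is no further from the edge than `w`.
    · have h1 : ‖(w : ℂ)‖ ≤ ‖x (ι w) * (1 - 1 / (n : ℂ))‖ + 10 / (n * c) := by
        have := norm_sub_norm_le (w : ℂ) (x (ι w) * (1 - 1 / (n : ℂ)))
        linarith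
      have h2 : ‖(1 : ℂ) - 1 / n‖ = 1 - 1 / n := by
        have h3 : (1 : ℂ) - 1 / n = ((1 - 1 / n : ℝ) : ℂ) := by push_cast; ring
        rw [h3, Complex.norm_real, Real.norm_of_nonneg]
        rw [sub_nonneg, div_le_one hn]
        linarith
      rw [norm_mul, h2] at h1
      have h3 : 10 / (n * c) ≤ 1 / 2 * (1 / n) := by
        rw [div_mul_div_comm, div_le_div_iff₀ (by positivity) (by positivity)]
        nlinarith [hs.le_c]
      have h4 : 1 / 2 * (1 / (n : ℝ)) ≤ ‖x (ι w)‖ * (1 / n) := by gcongr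
      have h5 := w.2.2.1
      linarith
    · rw [norm_div, div_le_iff₀ (by linarith)]
      calc ‖(w : ℂ) - x (ι w) * (1 - 1 / (n : ℂ))‖ ≤ 10 / (n * c) := hv.le
        _ = 20 / c / n * (1 / 2) := by field_simp; norm_num
        _ ≤ _ := by gcongr
    · field_simp
      ring

/-- Roots in the annulus of half the width have their critical points, at distance at most `2/n`,
inside the full annulus. These are distinct, because the roots are at least `2R ≥ 8/n > 4/n` apart.
-/
theorem WellSpread.enoughCriticalPoints (h : WellSpread x δ S (4 / c))
    (hs : EdgeScales n δ c S) {N : ℝ}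
    (hN : N ≤ (Finset.univ.filter fun i => 1 - (n : ℝ) ^ (-δ) / 2 ≤ ‖x i‖).card) :
    EnoughCriticalPoints x δ N := by
  have hn : (0 : ℝ) < n := by exact_mod_cast (by linarith [hs.two_le] : 0 < n)
  have hn2 : (2 : ℝ) ≤ n := by exact_mod_cast hs.two_le
  have hc : 0 < c := by linarith [hs.le_c]
  have hd : 0 < (n : ℝ) ^ (-δ) := by positivity
  have hfin : (edgeCriticalPoints x δ).Finite := by
    obtain ⟨ι, hι, -⟩ := h.criticalPointsToRoots hs
    exact Set.finite_coe_iff.1 (Finite.of_injective ι hι)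
  refine ⟨hfin, hN.trans ?_⟩
  set T := Finset.univ.filter fun i => 1 - (n : ℝ) ^ (-δ) / 2 ≤ ‖x i‖ with hT
  have hTm : ∀ i ∈ T, 1 - (n : ℝ) ^ (-δ) / 2 ≤ ‖x i‖ := fun i hi => (Finset.mem_filter.1 hi).2
  have hex : ∀ i ∈ T, ∃ w ∈ edgeCriticalPoints x δ, ‖w - x i‖ ≤ 2 / n := by
    intro i hi
    obtain ⟨-, w, h1, h2, -, -, -, h6⟩ := h.exists_criticalPoint hs
      (i := i) (by linarith [hTm i hi])
    refine ⟨w, ⟨h1, ?_, ?_⟩, h2⟩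
    · have h3 := norm_sub_norm_le (x i) w
      rw [norm_sub_rev] at h3
      have h4 : 2 / (n : ℝ) = 4 / n / 2 := by ring
      linarith [hTm i hi, hs.radius_lower, hs.radius_upper]
    · have h3 := norm_sub_norm_le w (x i * (1 - 1 / (n : ℂ)))
      have h2 : ‖(1 : ℂ) - 1 / n‖ = 1 - 1 / n := by
        have h3 : (1 : ℂ) - 1 / n = ((1 - 1 / n : ℝ) : ℂ) := by push_cast; ring
        rw [h3, Complex.norm_real, Real.norm_of_nonneg]
        rw [sub_nonneg, div_le_one hn]
        linarith
      rw [norm_mul, h2] at h3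
      have h4 : 10 / (n * c) ≤ 1 / n := by
        rw [div_le_div_iff₀ (by positivity) (by positivity)]
        nlinarith [hs.le_c]
      have h5 : 0 ≤ 1 - 1 / (n : ℝ) := by
        rw [sub_nonneg, div_le_one hn]
        linarith
      have h7 : ‖x i‖ * (1 - 1 / (n : ℝ)) ≤ 1 * (1 - 1 / (n : ℝ)) :=
        mul_le_mul_of_nonneg_right (h.norm_le i) h5
      linarith
  choose! f hf hfx using hex
  have hinj : Set.InjOn f T := by
    intro i hi j hj hij
    by_contra hne
    have h1 := h.separated i (by linarith [hTm i hi]) j (Ne.symm hne)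
    have h2 : ‖x i - x j‖ ≤ 2 / n + 2 / n := by
      calc ‖x i - x j‖ = ‖(f j - x j) - (f i - x i)‖ := by rw [hij]; congr 1; ring
        _ ≤ ‖f j - x j‖ + ‖f i - x i‖ := norm_sub_le _ _
        _ ≤ _ := add_le_add (hfx j hj) (hfx i hi)
    have h3 : 2 / (n : ℝ) + 2 / n = 4 / n := by ring
    have h4 : 0 < 4 / (n : ℝ) := by positivity
    linarith [hs.radius_lower]
  have h1 : (T.image f).card = T.card := Finset.card_image_of_injOn hinj
  have h2 : ((T.image f : Finset ℂ) : Set ℂ) ⊆ edgeCriticalPoints x δ := by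
    intro w hw
    obtain ⟨i, hi, rfl⟩ := Finset.mem_image.1 (Finset.mem_coe.1 hw)
    exact hf i hi
  have h3 := Set.ncard_le_ncard h2 hfin
  rw [Set.ncard_coe_finset, h1] at h3
  exact_mod_cast h3

/-- The field at a point is controlled by the cut-off field at a nearby point. -/
theorem norm_reciprocalSum_sub_div_le {z z' : ℂ} {s : Finset (Fin n)} {R h a : ℝ} (hR : 0 < R)
    (hh : h ≤ R / 4) (hzz : ‖z - z'‖ ≤ h) (hz : 1 / 2 ≤ ‖z‖) (hz' : 1 / 2 ≤ ‖z'‖)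
    (hin : ∀ j ∈ s, R ≤ ‖z - x j‖) (hout : ∀ j ∉ s, x j = z)
    (hcut : ‖∑ j, cutoffInv (R / 2) (z' - x j) - n / z'‖ ≤ n * a) :
    ‖reciprocalSum s x z - n / z‖ ≤ n * (a + 2 * h / R ^ 2 + 4 * h) := by
  have hh0 : 0 ≤ h := (norm_nonneg _).trans hzz
  have hin' : ∀ j ∈ s, R / 2 ≤ ‖z' - x j‖ := by
    intro j hj
    have h1 := norm_sub_norm_le (z - x j) (z - z')
    have h2 : z - x j - (z - z') = z' - x j := by ring
    rw [h2] at h1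
    linarith [hin j hj]
  -- The cut-off at `R/2` selects exactly `s`: indices in `s` stay at distance at least `R/2` from
  -- `z'`, while the others have `x_j = z`, within `R/4` of `z'`.
  have hsum : ∑ j, cutoffInv (R / 2) (z' - x j) = reciprocalSum s x z' := by
    unfold reciprocalSum
    rw [← Finset.sum_subset (Finset.subset_univ s)]
    · refine Finset.sum_congr rfl fun j hj => ?_
      rw [cutoffInv, if_pos (hin' j hj)]
    · intro j _ hj
      rw [hout j hj, cutoffInv, if_neg]
      rw [norm_sub_rev]
      linarith
  have h1 : ‖reciprocalSum s x z - reciprocalSum s x z'‖ ≤ n * (2 * h / R ^ 2) := by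
    unfold reciprocalSum
    rw [← Finset.sum_sub_distrib]
    calc ‖∑ j ∈ s, (1 / (z - x j) - 1 / (z' - x j))‖ ≤ ∑ _j ∈ s, 2 * h / R ^ 2 := by
          refine norm_sum_le_of_le _ fun j hj => ?_
          have ha := hin j hj
          have hb := hin' j hj
          have hz0 : z - x j ≠ 0 := norm_pos_iff.1 (by linarith)
          have hw0 : z' - x j ≠ 0 := norm_pos_iff.1 (by linarith)
          have : 1 / (z - x j) - 1 / (z' - x j) = -(z - z') / ((z - x j) * (z' - x j)) := by
            field_simp; ring
          rw [this, norm_div, norm_neg, norm_mul]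
          calc ‖z - z'‖ / (‖z - x j‖ * ‖z' - x j‖) ≤ h / (R * (R / 2)) := by gcongr
            _ = _ := by field_simp
      _ = s.card * (2 * h / R ^ 2) := by rw [Finset.sum_const, nsmul_eq_mul]
      _ ≤ _ := by
          gcongr
          simpa using Finset.card_le_univ s
  have h2 : ‖(n : ℂ) / z' - n / z‖ ≤ n * (4 * h) := by
    have hz0 : z ≠ 0 := norm_pos_iff.1 (by linarith)
    have hz0' : z' ≠ 0 := norm_pos_iff.1 (by linarith)
    have : (n : ℂ) / z' - n / z = n * ((z - z') / (z * z')) := by field_simp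
    rw [this, norm_mul, Complex.norm_natCast, norm_div, norm_mul]
    gcongr
    calc ‖z - z'‖ / (‖z‖ * ‖z'‖) ≤ h / (1 / 2 * (1 / 2)) := by gcongr
      _ = 4 * h := by ring
  rw [hsum] at hcut
  calc ‖reciprocalSum s x z - n / z‖ = ‖(reciprocalSum s x z - reciprocalSum s x z') +
        (reciprocalSum s x z' - n / z') + ((n : ℂ) / z' - n / z)‖ := by congr 1; ring
    _ ≤ n * (2 * h / R ^ 2) + n * a + n * (4 * h) :=
        (norm_add₃_le).trans (add_le_add (add_le_add h1 hcut) h2)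
    _ = _ := by ring

/-- Bounding the energy of a point by the near part of a pair energy and a trivial far part. -/
theorem sum_one_div_sq_le {s : Finset (Fin n)} {y : ℂ} {r p Q : ℝ} (hr : 0 < r) (hp0 : 0 < p)
    (hp2 : p ≤ 2) (hQ0 : 0 < Q)
    (hQ : ∑ j ∈ s, (if ‖y - x j‖ ≤ r then ‖y - x j‖ₑ ^ (-p) else 0) ≤ ENNReal.ofReal Q) :
    (∀ j ∈ s, x j ≠ y) ∧
      ∑ j ∈ s, 1 / ‖y - x j‖ ^ 2 ≤ Q ^ (2 / p) + s.card * (1 / r ^ 2) := by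
  have hne : ∀ j ∈ s, x j ≠ y := by
    intro j hj hxy
    -- A coincidence would contribute `0^(-p) = ⊤` to a sum bounded by `Q`.
    have h1 := (Finset.single_le_sum (f := fun j => if ‖y - x j‖ ≤ r then ‖y - x j‖ₑ ^ (-p) else 0)
      (fun _ _ => zero_le) hj).trans hQ
    simp [hxy, hr.le, hp0] at h1
  refine ⟨hne, ?_⟩
  have hpos : ∀ j ∈ s, 0 < ‖y - x j‖ := fun j hj =>
    norm_pos_iff.2 (sub_ne_zero.2 (hne j hj).symm)
  set a : Fin n → ℝ := fun j => if ‖y - x j‖ ≤ r then ‖y - x j‖ ^ (-p) else 0 with ha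
  have ha0 : ∀ j, 0 ≤ a j := fun j => by
    simp only [ha]; split_ifs <;> positivity
  have hQ' : ENNReal.ofReal (∑ j ∈ s, a j) ≤ ENNReal.ofReal Q := by
    refine le_of_eq_of_le ?_ hQ
    rw [ENNReal.ofReal_sum_of_nonneg fun j _ => ha0 j]
    refine Finset.sum_congr rfl fun j hj => ?_
    simp only [ha]
    split_ifs
    · rw [← ofReal_norm, ENNReal.ofReal_rpow_of_pos (hpos j hj)]
    · simp
  have hterm : ∀ j ∈ s, 1 / ‖y - x j‖ ^ 2 ≤ a j ^ (2 / p) + 1 / r ^ 2 := by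
    intro j hj
    have hj0 := hpos j hj
    by_cases hj1 : ‖y - x j‖ ≤ r
    · have h1 : a j ^ (2 / p) = 1 / ‖y - x j‖ ^ 2 := by
        simp only [ha, if_pos hj1]
        rw [← Real.rpow_mul hj0.le, show -p * (2 / p) = -2 by field_simp,
          Real.rpow_neg hj0.le, one_div]
        norm_num
      rw [h1]
      have : 0 ≤ 1 / r ^ 2 := by positivity
      linarith
    · have h1 : 1 / ‖y - x j‖ ^ 2 ≤ 1 / r ^ 2 := by
        push Not at hj1
        gcongr
      have := Real.rpow_nonneg (ha0 j) (2 / p)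
      linarith
  have hp1 : 1 ≤ 2 / p := by rw [le_div_iff₀ hp0]; linarith
  have hsum : ∑ j ∈ s, a j ≤ Q := (ENNReal.ofReal_le_ofReal_iff hQ0.le).1 hQ'
  -- Each `a_j` is at most the total `Q`, and `2/p ≥ 1`: the inclusion of `ℓ^1` in `ℓ^(2/p)`.
  have hpow : ∀ j ∈ s, a j ^ (2 / p) ≤ a j * Q ^ (2 / p - 1) := by
    intro j hj
    rcases (ha0 j).eq_or_lt with h0 | h0
    · rw [← h0, Real.zero_rpow (by positivity), zero_mul]
    · have h1 : a j ≤ Q := (Finset.single_le_sum (fun j _ => ha0 j) hj).trans hsum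
      calc a j ^ (2 / p) = a j * a j ^ (2 / p - 1) := by
            rw [← Real.rpow_one_add' h0.le (by simp [hp0.ne'])]
            ring_nf
        _ ≤ _ := by
            gcongr
  calc ∑ j ∈ s, 1 / ‖y - x j‖ ^ 2 ≤ ∑ j ∈ s, (a j * Q ^ (2 / p - 1) + 1 / r ^ 2) :=
        Finset.sum_le_sum fun j hj => (hterm j hj).trans (by linarith [hpow j hj])
    _ = (∑ j ∈ s, a j) * Q ^ (2 / p - 1) + s.card * (1 / r ^ 2) := by
        rw [Finset.sum_add_distrib, Finset.sum_const, nsmul_eq_mul, Finset.sum_mul]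
    _ ≤ Q * Q ^ (2 / p - 1) + s.card * (1 / r ^ 2) := by gcongr
    _ = _ := by
        rw [← Real.rpow_one_add' hQ0.le (by simp [hp0.ne'])]
        ring_nf

end WellSpread

/-! ### The good events and their probabilities. -/

section GoodEvents

variable {Ω : Type*} [MeasurableSpace Ω] {P : Measure Ω} [IsProbabilityMeasure P]
  {μ : Measure ℂ} [IsProbabilityMeasure μ] {α ε k K : ℝ} {X : ℕ → Ω → ℂ}

/-- The point of the square lattice of mesh `1 / m` with index `q`. -/
noncomputable def latticePoint (m : ℕ) (q : ℤ × ℤ) : ℂ := ⟨q.1 / m, q.2 / m⟩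

/-- The indices of the lattice points in the square `[-1, 1] × [-1, 1]`. -/
noncomputable def latticeIndices (m : ℕ) : Finset (ℤ × ℤ) :=
  Finset.Icc (-m : ℤ) m ×ˢ Finset.Icc (-m : ℤ) m

theorem card_latticeIndices (m : ℕ) : (latticeIndices m).card = (2 * m + 1) ^ 2 := by
  rw [latticeIndices, Finset.card_product, Int.card_Icc, ← sq]
  congr 1
  omega

theorem exists_floor_div_near {m : ℕ} (hm : 0 < m) {y : ℝ} (hy : |y| ≤ 1) :
    ∃ a ∈ Finset.Icc (-m : ℤ) m, |y - a / m| ≤ 1 / m := by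
  have hm' : (0 : ℝ) < m := by exact_mod_cast hm
  obtain ⟨h1, h2⟩ := abs_le.1 hy
  refine ⟨⌊m * y⌋, Finset.mem_Icc.2 ⟨Int.le_floor.2 ?_, ?_⟩, ?_⟩
  · push_cast
    nlinarith
  · have : (⌊m * y⌋ : ℝ) ≤ m := (Int.floor_le _).trans (by nlinarith)
    exact_mod_cast this
  · have h3 : y - ⌊m * y⌋ / m = (m * y - ⌊m * y⌋) / m := by field_simp
    rw [h3, abs_div, abs_of_pos hm', Int.self_sub_floor, abs_of_nonneg (Int.fract_nonneg _)]
    gcongr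
    exact (Int.fract_lt_one _).le

theorem exists_latticePoint_near {m : ℕ} (hm : 0 < m) {z : ℂ} (hz : ‖z‖ ≤ 1) :
    ∃ q ∈ latticeIndices m, ‖z - latticePoint m q‖ ≤ 2 / m := by
  obtain ⟨a, ha, ha'⟩ := exists_floor_div_near hm ((Complex.abs_re_le_norm z).trans hz)
  obtain ⟨b, hb, hb'⟩ := exists_floor_div_near hm ((Complex.abs_im_le_norm z).trans hz)
  refine ⟨(a, b), Finset.mem_product.2 ⟨ha, hb⟩, ?_⟩
  refine (Complex.norm_le_abs_re_add_abs_im _).trans ?_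
  calc _ ≤ 1 / (m : ℝ) + 1 / m := add_le_add ha' hb'
    _ = _ := by ring

/-- Simultaneous concentration of the cut-off field at all lattice points near the edge. -/
theorem EdgeRegular.exists_measure_lattice_le (h : EdgeRegular μ α ε k K)
    (hXmeas : ∀ i, Measurable (X i)) (hXindep : iIndepFun X P) (hXlaw : ∀ i, P.map (X i) = μ) :
    ∃ L : ℝ, 0 < L ∧ ∀ (n m : ℕ) (ρ c : ℝ), 0 < ρ → 1 ≤ c →
      P.real {ω | ∃ q ∈ latticeIndices m, 1 - ε / 2 ≤ ‖latticePoint m q‖ ∧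
        n / c < ‖∑ i : Fin n, cutoffInv ρ (latticePoint m q - X i ω) -
          n * ∫ u, cutoffInv ρ (latticePoint m q - u) ∂μ‖} ≤
        (2 * m + 1) ^ 2 * (4 * Real.exp (-(n * ρ / (L * c ^ 2)))) := by
  obtain ⟨L, hL, hb⟩ := h.exists_integral_norm_cutoffInv_le
  refine ⟨16 * (L + 1), by positivity, fun n m ρ c hρ hc => ?_⟩
  have hc0 : 0 < c := by linarith
  have hpoint : ∀ z : ℂ, 1 - ε / 2 ≤ ‖z‖ →
      P.real {ω | n / c < ‖∑ i : Fin n, cutoffInv ρ (z - X i ω) -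
        n * ∫ u, cutoffInv ρ (z - u) ∂μ‖} ≤
      4 * Real.exp (-(n * ρ / (16 * (L + 1) * c ^ 2))) := by
    intro z hz
    have hv : ∫ u, ‖cutoffInv ρ (z - u)‖ ^ 2 ∂μ ≤ L / ρ := by
      have hi := (integrable_cutoffInv (μ := μ) hρ z).norm
      calc ∫ u, ‖cutoffInv ρ (z - u)‖ ^ 2 ∂μ ≤ ∫ u, 1 / ρ * ‖cutoffInv ρ (z - u)‖ ∂μ := by
            refine integral_mono_of_nonneg (ae_of_all _ fun u => by positivity)
              (hi.const_mul _) (ae_of_all _ fun u => ?_)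
            simp only
            rw [sq]
            exact mul_le_mul_of_nonneg_right (norm_cutoffInv_le hρ _) (norm_nonneg _)
        _ = 1 / ρ * ∫ u, ‖cutoffInv ρ (z - u)‖ ∂μ := integral_const_mul _ _
        _ ≤ 1 / ρ * L := by gcongr; exact hb z hz ρ hρ
        _ = L / ρ := by ring
    -- With `E = nρ / (16 (L+1) c^2)`, this `l` makes the linear term `-2E` and the variance term at
    -- most `E`.
    refine (measure_norm_sum_sub_le hXmeas hXindep hXlaw n
      (φ := fun u => cutoffInv ρ (z - u)) ((measurable_cutoffInv ρ).comp (by fun_prop))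
      (fun u => norm_cutoffInv_le hρ _) hv (l := ρ / (4 * (L + 1) * c)) (by positivity) ?_
      (n / c)).trans ?_
    · rw [div_mul_div_comm, mul_one, div_le_one (by positivity)]
      have : 1 ≤ 4 * (L + 1) * c := by nlinarith
      nlinarith
    · gcongr
      have h1 : n * ((ρ / (4 * (L + 1) * c)) ^ 2 * (L / ρ)) =
          n * ρ / (16 * (L + 1) * c ^ 2) * (L / (L + 1)) := by
        field_simp; ring
      have h2 : ρ / (4 * (L + 1) * c) * (n / c / 2) =
          2 * (n * ρ / (16 * (L + 1) * c ^ 2)) := by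
        field_simp; ring
      have h3 : L / (L + 1) ≤ 1 := by rw [div_le_one (by positivity)]; linarith
      have h4 : 0 ≤ n * ρ / (16 * (L + 1) * c ^ 2) := by positivity
      rw [h1, h2]
      nlinarith
  classical
  set N := (latticeIndices m).filter fun q => 1 - ε / 2 ≤ ‖latticePoint m q‖ with hN
  calc _ ≤ P.real (⋃ q ∈ N, {ω | n / c < ‖∑ i : Fin n, cutoffInv ρ (latticePoint m q - X i ω) -
          n * ∫ u, cutoffInv ρ (latticePoint m q - u) ∂μ‖}) := by
        refine measureReal_mono ?_ (measure_ne_top _ _)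
        rintro ω ⟨q, hq, hq1, hq2⟩
        exact Set.mem_biUnion (show q ∈ N from Finset.mem_filter.2 ⟨hq, hq1⟩) hq2
    _ ≤ ∑ q ∈ N, P.real {ω | n / c < ‖∑ i : Fin n, cutoffInv ρ (latticePoint m q - X i ω) -
          n * ∫ u, cutoffInv ρ (latticePoint m q - u) ∂μ‖} := measureReal_biUnion_finset_le _ _
    _ ≤ N.card • (4 * Real.exp (-(n * ρ / (16 * (L + 1) * c ^ 2)))) :=
        Finset.sum_le_card_nsmul _ _ _ fun q hq => hpoint _ (Finset.mem_filter.1 hq).2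
    _ ≤ _ := by
        rw [nsmul_eq_mul]
        gcongr
        have : N.card ≤ (2 * m + 1) ^ 2 :=
          (Finset.card_filter_le _ _).trans (card_latticeIndices m).le
        exact_mod_cast this

open Classical in
/-- The singular interaction of a point at the edge with a point nearby. -/
noncomputable def edgePairEnergy (s t p : ℝ) (q : ℂ × ℂ) : ENNReal :=
  if q.1 ∈ edgeAnnulus s ∧ ‖q.1 - q.2‖ ≤ t then ‖q.1 - q.2‖ₑ ^ (-p) else 0

theorem measurable_edgePairEnergy (s t p : ℝ) : Measurable (edgePairEnergy s t p) := by
  unfold edgePairEnergy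
  refine Measurable.ite ?_ (by fun_prop) measurable_const
  exact (measurable_fst (measurableSet_edgeAnnulus s)).inter
    (measurableSet_le (f := fun q : ℂ × ℂ => ‖q.1 - q.2‖) (by fun_prop) measurable_const)

/-- The inner integral of the pair mean is `O(t^α)` by the density near the edge, and the outer one
runs over an annulus of mass `O(s^(α+1))`. The condition `s ≤ t` puts the first point within reach
of the kernel bound. -/
theorem EdgeRegular.exists_measure_pairs_le (h : EdgeRegular μ α ε k K)
    (hXmeas : ∀ i, Measurable (X i)) (hXindep : iIndepFun X P) (hXlaw : ∀ i, P.map (X i) = μ)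
    {p : ℝ} (hp : p < 2) :
    ∃ A : ℝ, 0 < A ∧ ∀ (n : ℕ) (s t Q : ℝ), 0 < s → s ≤ t → 2 * t ≤ ε → 0 < Q →
      P.real {ω | ENNReal.ofReal Q ≤ ∑ i : Fin n, ∑ j ∈ Finset.univ.erase i,
        edgePairEnergy s t p (X i ω, X j ω)} ≤ n ^ 2 * (A * s ^ (α + 1) * t ^ α) / Q := by
  obtain ⟨L, hL, hb⟩ := h.exists_setLIntegral_le hp
  have hK := h.upper_pos
  have hpi := Real.pi_pos
  refine ⟨2 * Real.pi * K * L, by positivity, fun n s t Q hs hst ht hQ => ?_⟩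
  have ht0 : 0 < t := by linarith
  refine measure_sum_pairs_ge_le hXmeas hXindep hXlaw n (measurable_edgePairEnergy s t p)
    (by positivity) ?_ hQ
  calc ∫⁻ u, ∫⁻ w, edgePairEnergy s t p (u, w) ∂μ ∂μ
      ≤ ∫⁻ u, (edgeAnnulus s).indicator (fun _ => ENNReal.ofReal (L * t ^ α)) u ∂μ := by
        refine lintegral_mono fun u => ?_
        by_cases hu : u ∈ edgeAnnulus s
        · rw [Set.indicator_of_mem hu]
          refine le_trans (le_of_eq ?_) (hb t ht0 ht u (by linarith [hu.1]))
          rw [← lintegral_indicator measurableSet_closedBall]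
          refine lintegral_congr fun w => ?_
          have hw : w ∈ Metric.closedBall u t ↔ ‖u - w‖ ≤ t := by
            rw [Metric.mem_closedBall, dist_eq_norm, norm_sub_rev]
          by_cases hwt : ‖u - w‖ ≤ t
          · rw [Set.indicator_of_mem (hw.2 hwt)]
            simp [edgePairEnergy, hu, hwt]
          · rw [Set.indicator_of_notMem (mt hw.1 hwt)]
            simp [edgePairEnergy, hwt]
        · simp [edgePairEnergy, hu]
    _ = ENNReal.ofReal (L * t ^ α) * μ (edgeAnnulus s) := by
        rw [lintegral_indicator_const (measurableSet_edgeAnnulus s)]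
    _ ≤ ENNReal.ofReal (L * t ^ α) * ENNReal.ofReal (2 * Real.pi * K * s ^ (α + 1)) := by
        gcongr
        exact h.measure_edgeAnnulus_le hs (by linarith)
    _ = _ := by
        rw [← ENNReal.ofReal_mul (by positivity)]
        congr 1
        ring

/-- The number of points at distance at most `t` from the edge is at least half its lower bound
in mean, outside an exponentially small event. -/
theorem EdgeRegular.measure_card_lt_le (h : EdgeRegular μ α ε k K)
    (hXmeas : ∀ i, Measurable (X i)) (hXindep : iIndepFun X P) (hXlaw : ∀ i, P.map (X i) = μ)
    (n : ℕ) {t : ℝ} (ht : 0 < t) (htε : t ≤ ε) :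
    P.real {ω | ((Finset.univ.filter fun i : Fin n => 1 - t ≤ ‖X i ω‖).card : ℝ) <
      k / 2 * (n * t ^ (α + 1))} ≤ Real.exp (-(k / 16 * (n * t ^ (α + 1)))) := by
  have hk := h.lower_pos
  set q := μ.real (edgeAnnulus t) with hq
  have hqk : k * t ^ (α + 1) ≤ q := by
    refine (ENNReal.ofReal_le_iff_le_toReal (measure_ne_top _ _)).1 (h.le_measure t ht htε)
  set φ : ℂ → ℝ := (edgeAnnulus t).indicator fun _ => -1 with hφ
  have hAm := measurableSet_edgeAnnulus t
  have hφm : Measurable φ := measurable_const.indicator hAm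
  have hφb : ∀ u, |φ u| ≤ 1 := fun u => by
    by_cases hu : u ∈ edgeAnnulus t <;> simp [hφ, hu]
  have hφ1 : ∫ u, φ u ∂μ = -q := by
    rw [hφ, integral_indicator_const _ hAm]
    simp [hq]
  have hφ2 : ∫ u, φ u ^ 2 ∂μ ≤ q := by
    have : (fun u => φ u ^ 2) = (edgeAnnulus t).indicator fun _ => (1 : ℝ) := by
      ext u
      by_cases hu : u ∈ edgeAnnulus t <;> simp [hφ, hu]
    rw [this, integral_indicator_const _ hAm]
    simp [hq]
  -- The sign of `φ` turns a deficit of points into an upper tail. The exponent is `-nq/8 + nq/16 =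
  -- -nq/16`.
  have key := measure_sum_ge_le hXmeas hXindep hXlaw n hφm hφb hφ2 (l := 1 / 4) (by norm_num)
    (by norm_num) (n * q / 2)
  refine (measureReal_mono ?_).trans (key.trans (Real.exp_le_exp.2 ?_))
  · intro ω hω
    rw [Set.mem_ofPred_eq] at hω ⊢
    have hcard : -((Finset.univ.filter fun i : Fin n => 1 - t ≤ ‖X i ω‖).card : ℝ) ≤
        ∑ i : Fin n, φ (X i ω) := by
      rw [Finset.card_filter]
      push_cast
      rw [← Finset.sum_neg_distrib]
      refine Finset.sum_le_sum fun i _ => ?_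
      by_cases hi : X i ω ∈ edgeAnnulus t
      · simp [hφ, hi, hi.1]
      · rw [hφ, Set.indicator_of_notMem hi]
        split_ifs <;> norm_num
    rw [hφ1]
    have : (n : ℝ) * (k * t ^ (α + 1)) ≤ n * q := by gcongr
    nlinarith
  · have : (n : ℝ) * (k * t ^ (α + 1)) ≤ n * q := by gcongr
    nlinarith

end GoodEvents

/-- The good events imply that a configuration is well spread. -/
theorem wellSpread_of_good {μ : Measure ℂ} {ε : ℝ} {n m : ℕ} {x : Fin n → ℂ}
    {δ t p Q c S τ : ℝ} (hm : 0 < m) (hp0 : 0 < p) (hp2 : p ≤ 2) (hQ : 0 < Q) (ht : 0 < t)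
    (hδε : 6 * (n : ℝ) ^ (-δ) ≤ ε) (hε : ε ≤ 1 / 2)
    (hR : 0 < isolationRadius n δ) (hRδ : isolationRadius n δ ≤ (n : ℝ) ^ (-δ))
    (hmR : 2 / (m : ℝ) ≤ isolationRadius n δ / 4)
    (hS : Q ^ (2 / p) + n * (1 / t ^ 2) ≤ S) (hSR : 4 * isolationRadius n δ ^ 2 * S ≤ 1)
    (hτ : 1 / c + τ + 2 * (2 / m) / isolationRadius n δ ^ 2 + 4 * (2 / m) ≤ 4 / c)
    (hmean : ∀ z : ℂ, 1 - 3 * (n : ℝ) ^ (-δ) ≤ ‖z‖ →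
      ‖∫ u, cutoffInv (isolationRadius n δ / 2) (z - u) ∂μ - 1 / z‖ ≤ τ)
    (hnorm : ∀ j, ‖x j‖ ≤ 1)
    (hnet : ∀ q ∈ latticeIndices m, 1 - ε / 2 ≤ ‖latticePoint m q‖ →
      ‖∑ i, cutoffInv (isolationRadius n δ / 2) (latticePoint m q - x i) -
        n * ∫ u, cutoffInv (isolationRadius n δ / 2) (latticePoint m q - u) ∂μ‖ ≤ n / c)
    (hpairs : ∑ i, ∑ j ∈ Finset.univ.erase i,
      edgePairEnergy (2 * (n : ℝ) ^ (-δ)) t p (x i, x j) ≤ ENNReal.ofReal Q) :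
    WellSpread x δ S (4 / c) := by
  have hi : ∀ i, 1 - 2 * (n : ℝ) ^ (-δ) ≤ ‖x i‖ →
      (∀ j ∈ Finset.univ.erase i, x j ≠ x i) ∧
        ∑ j ∈ Finset.univ.erase i, 1 / ‖x i - x j‖ ^ 2 ≤ S := by
    intro i hi
    have h1 : ∑ j ∈ Finset.univ.erase i,
        (if ‖x i - x j‖ ≤ t then ‖x i - x j‖ₑ ^ (-p) else 0) ≤ ENNReal.ofReal Q := by
      refine le_trans (le_of_eq (Finset.sum_congr rfl fun j _ => ?_))
        ((Finset.single_le_sum (f := fun i => ∑ j ∈ Finset.univ.erase i,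
          edgePairEnergy (2 * (n : ℝ) ^ (-δ)) t p (x i, x j))
          (fun _ _ => zero_le) (Finset.mem_univ i)).trans hpairs)
      have : x i ∈ edgeAnnulus (2 * (n : ℝ) ^ (-δ)) := ⟨hi, hnorm i⟩
      simp [edgePairEnergy, this]
    obtain ⟨h2, h3⟩ := sum_one_div_sq_le ht hp0 hp2 hQ h1
    refine ⟨h2, h3.trans (le_trans ?_ hS)⟩
    gcongr
    simp
  refine ⟨hnorm, fun i hi' j hj => ?_, fun i hi' => (hi i hi').2, ?_⟩
  · obtain ⟨h1, h2⟩ := hi i hi'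
    have hmem : j ∈ Finset.univ.erase i := Finset.mem_erase.2 ⟨hj, Finset.mem_univ _⟩
    have hpos : 0 < ‖x i - x j‖ := norm_pos_iff.2 (sub_ne_zero.2 (h1 j hmem).symm)
    have h3 : 1 / ‖x i - x j‖ ^ 2 ≤ S :=
      (Finset.single_le_sum (f := fun j => 1 / ‖x i - x j‖ ^ 2)
        (fun _ _ => by positivity) hmem).trans h2
    rw [div_le_iff₀ (by positivity)] at h3
    -- Separation needs no event of its own: one term of the energy is at most `S`, and `4 R^2 S ≤
    -- 1`.
    refine le_of_sq_le_sq ?_ hpos.le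
    have h4 : 4 * isolationRadius n δ ^ 2 * 1 ≤
        4 * isolationRadius n δ ^ 2 * (S * ‖x i - x j‖ ^ 2) := by gcongr
    have h5 : 4 * isolationRadius n δ ^ 2 * S * ‖x i - x j‖ ^ 2 ≤ 1 * ‖x i - x j‖ ^ 2 := by
      gcongr
    nlinarith
  · intro z s hz hz1 hin hout
    obtain ⟨q, hq, hqz⟩ := exists_latticePoint_near hm hz1
    have hq1 : 1 - 3 * (n : ℝ) ^ (-δ) ≤ ‖latticePoint m q‖ := by
      linarith [norm_sub_norm_le z (latticePoint m q)]
    have hcut : ‖∑ j, cutoffInv (isolationRadius n δ / 2) (latticePoint m q - x j) -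
        n / latticePoint m q‖ ≤ n * (1 / c + τ) := by
      set I := ∫ u, cutoffInv (isolationRadius n δ / 2) (latticePoint m q - u) ∂μ
      have h1 := hnet q hq (by linarith)
      have h2 : ‖(n : ℂ) * (I - 1 / latticePoint m q)‖ ≤ n * τ := by
        rw [norm_mul, Complex.norm_natCast]
        gcongr
        exact hmean _ hq1
      calc _ = ‖(∑ j, cutoffInv (isolationRadius n δ / 2) (latticePoint m q - x j) - n * I) +
            n * (I - 1 / latticePoint m q)‖ := by congr 1; ring
        _ ≤ n / c + n * τ := (norm_add_le _ _).trans (add_le_add h1 h2)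
        _ = _ := by ring
    refine (norm_reciprocalSum_sub_div_le hR hmR hqz (by linarith) (by linarith) hin hout
      hcut).trans ?_
    gcongr

/-! ### Comparison of powers of `n`. -/

section Asymptotics

theorem eventually_const_mul_rpow_le (K : ℝ) {a b : ℝ} (hab : a < b) :
    ∀ᶠ n : ℕ in atTop, K * (n : ℝ) ^ a ≤ (n : ℝ) ^ b := by
  have h1 := ((tendsto_rpow_atTop (sub_pos.2 hab)).comp
    tendsto_natCast_atTop_atTop).eventually_ge_atTop K
  filter_upwards [h1, eventually_gt_atTop 0] with n hn hn0
  have hn0' : (0 : ℝ) < n := by exact_mod_cast hn0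
  have h2 : (n : ℝ) ^ b = (n : ℝ) ^ (b - a) * (n : ℝ) ^ a := by
    rw [← Real.rpow_add hn0']; ring_nf
  rw [h2]
  exact mul_le_mul_of_nonneg_right hn (by positivity)

theorem eventually_exp_neg_rpow_le {e : ℝ} (he : 0 < e) (b : ℝ) :
    ∀ᶠ n : ℕ in atTop, Real.exp (-(n : ℝ) ^ e) ≤ (n : ℝ) ^ (-b) := by
  have h1 := ((isLittleO_log_rpow_atTop he).comp_tendsto
    tendsto_natCast_atTop_atTop).bound (show 0 < 1 / (|b| + 1) by positivity)
  filter_upwards [h1, eventually_gt_atTop 0] with n hn hn0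
  have hn0' : (1 : ℝ) ≤ n := by exact_mod_cast hn0
  have hlog : 0 ≤ Real.log n := Real.log_nonneg hn0'
  simp only [Function.comp_apply, Real.norm_eq_abs] at hn
  rw [abs_of_nonneg hlog, abs_of_nonneg (Real.rpow_nonneg (by linarith) e), one_div,
    ← div_eq_inv_mul, le_div_iff₀ (by positivity)] at hn
  rw [Real.rpow_def_of_pos (y := -b) (by linarith)]
  refine Real.exp_le_exp.2 ?_
  have : b * Real.log n ≤ |b| * Real.log n := mul_le_mul_of_nonneg_right (le_abs_self b) hlog
  nlinarith

variable {c : ℕ → ℝ}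

/-- The hypothesis on `log c_n` enters only in this form: `c_n` is eventually below every positive
power of `n`. -/
theorem eventually_le_rpow (hcpos : ∀ n, 0 < c n)
    (hclog : (fun n => Real.log (c n)) =o[atTop] (fun n : ℕ => Real.log n)) {e : ℝ}
    (he : 0 < e) : ∀ᶠ n : ℕ in atTop, c n ≤ (n : ℝ) ^ e := by
  filter_upwards [hclog.bound he, eventually_gt_atTop 0] with n hn hn0
  have hn0' : (1 : ℝ) ≤ n := by exact_mod_cast hn0
  rw [Real.norm_eq_abs, Real.norm_of_nonneg (Real.log_nonneg hn0')] at hn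
  rw [Real.rpow_def_of_pos (by linarith), ← Real.log_le_iff_le_exp (hcpos n), mul_comm]
  exact (le_abs_self _).trans hn

theorem eventually_const_mul_mul_rpow_le (hcpos : ∀ n, 0 < c n)
    (hclog : (fun n => Real.log (c n)) =o[atTop] (fun n : ℕ => Real.log n)) {K : ℝ}
    (hK : 0 ≤ K) {a b : ℝ} (hab : a < b) :
    ∀ᶠ n : ℕ in atTop, K * c n * (n : ℝ) ^ a ≤ (n : ℝ) ^ b := by
  filter_upwards [eventually_le_rpow hcpos hclog (half_pos (sub_pos.2 hab)),
    eventually_const_mul_rpow_le K (show a + (b - a) / 2 < b by linarith),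
    eventually_gt_atTop 0] with n h1 h2 hn0
  have hn0' : (0 : ℝ) < n := by exact_mod_cast hn0
  refine le_trans ?_ h2
  rw [Real.rpow_add hn0', mul_comm ((n : ℝ) ^ a), ← mul_assoc]
  gcongr

/-- The threshold for `σ` is forced by `S/n^3 ≪ n^(-(3-δ)/2)`. For such `σ`, the condition `R S ≪ n`
then follows from `δ < 1`. -/
theorem eventually_edgeScales (hcpos : ∀ n, 0 < c n) (hc : Tendsto c atTop atTop)
    (hclog : (fun n => Real.log (c n)) =o[atTop] (fun n : ℕ => Real.log n)) {δ σ : ℝ}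
    (hδ0 : 0 < δ) (hδ1 : δ < 1) (hσ : σ < (3 + δ) / 2) :
    ∀ᶠ n : ℕ in atTop, EdgeScales n δ (c n) (2 * (n : ℝ) ^ σ) := by
  filter_upwards [eventually_ge_atTop 2, hc.eventually_ge_atTop 32,
    eventually_const_mul_rpow_le 4 (show -δ < 0 by linarith),
    eventually_const_mul_rpow_le 4 (show (-1 : ℝ) < -(5 + δ) / 6 by linarith),
    eventually_const_mul_rpow_le 1 (show -(5 + δ) / 6 < -δ by linarith),
    eventually_const_mul_rpow_le 32 (show -(5 + δ) / 6 + σ < 1 by linarith),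
    eventually_const_mul_rpow_le 64 (show σ < 2 by linarith),
    eventually_const_mul_rpow_le 256 hσ,
    eventually_const_mul_rpow_le 8 (show (-2 : ℝ) < -((3 - δ) / 2) by linarith),
    eventually_const_mul_mul_rpow_le hcpos hclog (show (0 : ℝ) ≤ 32 by norm_num)
      (show σ < 2 by linarith)] with n h2 hc32 e1 e2 e3 e4 e5 e6 e7 e8
  have hn : (0 : ℝ) < n := by exact_mod_cast (by omega : 0 < n)
  have hcn := hcpos n
  rw [Real.rpow_zero] at e1
  rw [Real.rpow_neg_one] at e2
  rw [one_mul] at e3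
  rw [Real.rpow_one, Real.rpow_add hn] at e4
  rw [Real.rpow_two] at e5 e8
  rw [Real.rpow_neg hn.le, Real.rpow_two] at e7
  refine ⟨h2, hc32, by linarith, by rw [div_eq_mul_inv]; exact e2, e3, ?_, by linarith, ?_, ?_⟩
  · unfold isolationRadius
    linarith
  · rw [Real.rpow_neg hn.le, ← one_div ((n : ℝ) ^ ((3 - δ) / 2))] at e7
    have h3 : 32 * (2 * (n : ℝ) ^ σ) / n ^ 3 ≤ 1 / 4 * (1 / (n : ℝ) ^ ((3 - δ) / 2)) := by
      have h4 : (n : ℝ) ^ ((3 + δ) / 2) * (n : ℝ) ^ ((3 - δ) / 2) = n ^ 3 := by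
        rw [← Real.rpow_add hn, ← Real.rpow_natCast]
        congr 1
        push_cast
        ring
      have h5 : 0 < (n : ℝ) ^ ((3 - δ) / 2) := by positivity
      rw [mul_one_div, div_le_div_iff₀ (by positivity) h5, ← h4]
      nlinarith
    have h6 : 0 < 1 / (n : ℝ) ^ ((3 - δ) / 2) := by positivity
    have h7 : 2 / (n : ℝ) ^ 2 = 2 * ((n : ℝ) ^ 2)⁻¹ := by rw [div_eq_mul_inv]
    rw [h7]
    linarith
  · rw [div_lt_div_iff₀ (by positivity) hcn]
    have : 0 < (n : ℝ) ^ 2 := by positivity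
    linarith

end Asymptotics

/-- `n^(-β)` is the near range of the pair energy, `n^a` the Markov threshold and `n^b` the
resulting energy bound. For `δ < 1/3`, `β = δ` works, and `2 - δ(2α+1) < (3+δ)/2` is precisely `δ >
1/(4α+3)`. For larger `δ`, `β = δ` would make `1 + 2β` too big and `β = 1/4` is enough; at `α = 0`
the hypothesis reads `δ > 1/3`. -/
theorem exists_edge_exponents {α δ : ℝ} (hα : 0 ≤ α) (hδ : 1 / (4 * α + 3) < δ)
    (hδ' : δ < 1 / (α + 1)) :
    0 < δ ∧ δ < 1 ∧ δ * (α + 1) < 1 ∧ ∃ β a b : ℝ, 0 < β ∧ β ≤ δ ∧ 1 + 2 * β < (3 + δ) / 2 ∧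
      0 < a ∧ 2 - δ * (α + 1) - β * α < a ∧ a < b ∧ b < (3 + δ) / 2 := by
  have hδ0 : 0 < δ := lt_trans (by positivity) hδ
  rw [div_lt_iff₀ (by positivity)] at hδ
  rw [lt_div_iff₀ (by positivity)] at hδ'
  have hδ1 : δ < 1 := by nlinarith
  refine ⟨hδ0, hδ1, hδ', ?_⟩
  obtain ⟨β, h1, h2, h3, h4⟩ : ∃ β : ℝ, 0 < β ∧ β ≤ δ ∧ 1 + 2 * β < (3 + δ) / 2 ∧
      2 - δ * (α + 1) - β * α < (3 + δ) / 2 := by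
    rcases lt_or_ge δ (1 / 3) with h | h
    · exact ⟨δ, hδ0, le_rfl, by linarith, by nlinarith⟩
    · refine ⟨1 / 4, by norm_num, by linarith, by linarith, ?_⟩
      rcases hα.eq_or_lt with h0 | h0
      · rw [← h0] at hδ ⊢
        linarith
      · nlinarith
  have h5 : 0 < 2 - δ * (α + 1) - β * α := by nlinarith
  set a₀ := 2 - δ * (α + 1) - β * α
  exact ⟨β, (2 * a₀ + (3 + δ) / 2) / 3, (a₀ + 2 * ((3 + δ) / 2)) / 3, h1, h2, h3,
    by linarith, by linarith, by linarith, by linarith⟩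

/-! ### Assembly: four exceptional events. -/

set_option maxHeartbeats 1000000 in
theorem theorem2p3
    {Ω : Type*} [MeasurableSpace Ω] (P : Measure Ω) [IsProbabilityMeasure P]
    (μ : Measure ℂ) [IsProbabilityMeasure μ]
    (α : ℝ) (hα : 0 ≤ α) (hμ : RadialWithEdgeExponent μ α)
    (X : ℕ → Ω → ℂ) (hXmeas : ∀ i, Measurable (X i))
    (hXindep : iIndepFun X P) (hXlaw : ∀ i, P.map (X i) = μ)
    (δ : ℝ) (hδ : 1 / (4 * α + 3) < δ) (hδ' : δ < 1 / (α + 1))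
    (c : ℕ → ℝ) (hcpos : ∀ n, 0 < c n) (hc : Tendsto c atTop atTop)
    (hclog : (fun n => Real.log (c n)) =o[atTop] (fun n : ℕ => Real.log n)) :
    ∃ C : ℝ, 0 < C ∧ ∃ η : ℕ → ℝ, Tendsto η atTop (𝓝 0) ∧
      (fun n : ℕ => P.real {ω | ¬
        (EnoughCriticalPoints (fun i : Fin n => X i ω) δ
            ((n : ℝ) ^ (1 - δ * (α + 1)) / (c n * Real.log n)) ∧
          RootsToCriticalPoints (fun i : Fin n => X i ω) δ (c n) C ∧
          CriticalPointsToRoots (fun i : Fin n => X i ω) δ (c n) C (η n))})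
        =O[atTop] (fun n => (c n)⁻¹) := by
  obtain ⟨ε, k, K, hE⟩ := hμ.edgeRegular hα
  obtain ⟨hδ0, hδ1, hδα, β, a, b, hβ0, hβδ, hβ, ha0, haa, hab, hb⟩ :=
    exists_edge_exponents hα hδ hδ'
  have hb0 : 0 < b := ha0.trans hab
  have hε0 := hE.eps_pos
  have hk := hE.lower_pos
  -- Chosen so that `(n^a)^(2/p) = n^b`; `a < b` gives `p < 2`.
  set p : ℝ := 2 * a / b with hp
  have hp0 : 0 < p := by positivity
  have hp2 : p < 2 := by rw [hp, div_lt_iff₀ hb0]; linarith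
  set σ := max b (1 + 2 * β) with hσ
  have hσ1 : σ < (3 + δ) / 2 := max_lt hb hβ
  set γ := 1 - δ * (α + 1) with hγ
  have hγ0 : 0 < γ := by linarith
  obtain ⟨L₁, hL₁, hmean⟩ := hE.exists_norm_integral_cutoffInv_sub_le
  obtain ⟨L₂, hL₂, hlattice⟩ := hE.exists_measure_lattice_le hXmeas hXindep hXlaw
  obtain ⟨A, hA, hpairs⟩ := hE.exists_measure_pairs_le hXmeas hXindep hXlaw hp2
  refine ⟨10, by norm_num, fun n => 20 / c n, hc.const_div_atTop 20, ?_⟩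
  -- Three events of probability at most `1/c_n` each, and a null event for points outside the disk.
  refine IsBigO.of_bound 3 ?_
  set k' : ℝ := k / 16 * (1 / 2) ^ (α + 1) with hk'
  have hk'0 : 0 < k' := by positivity
  filter_upwards [eventually_edgeScales hcpos hc hclog hδ0 hδ1 hσ1,
    eventually_le_rpow hcpos hclog one_pos,
    eventually_le_rpow hcpos hclog (show 0 < (1 - δ) / 48 by linarith),
    eventually_const_mul_rpow_le (8 / ε) (show -δ < 0 by linarith),
    eventually_const_mul_rpow_le (4 / ε) (show -β < 0 by linarith),
    eventually_const_mul_rpow_le 8 (show σ - (5 + δ) / 3 < 0 by linarith),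
    eventually_const_mul_mul_rpow_le hcpos hclog hL₁.le (show -δ / 4 < 0 by linarith),
    eventually_const_mul_mul_rpow_le hcpos hclog
      (show 0 ≤ A * 2 ^ (α + 1) * 2 ^ α by positivity) haa,
    eventually_const_mul_rpow_le (2 * L₂)
      (show (1 - δ) / 24 + (1 - δ) / 12 < (1 - δ) / 6 by linarith),
    eventually_exp_neg_rpow_le (show 0 < (1 - δ) / 12 by linarith) 10,
    eventually_const_mul_mul_rpow_le hcpos hclog (show (0 : ℝ) ≤ 36 by norm_num)
      (show (-2 : ℝ) < 0 by norm_num),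
    eventually_const_mul_rpow_le (1 / k') (show γ / 2 < γ by linarith),
    eventually_exp_neg_rpow_le (show 0 < γ / 2 by linarith) 1,
    (hc.atTop_mul_atTop₀ (Real.tendsto_log_atTop.comp
      tendsto_natCast_atTop_atTop)).eventually_ge_atTop (1 / (8 * k'))]
    with n hs hc1 hc48 e1 e2 e3 e4 e5 e6 e7 e8 e9 e10 e11
  have hn2 : (2 : ℝ) ≤ n := by exact_mod_cast hs.two_le
  have hn : (0 : ℝ) < n := by linarith
  have hcn := hcpos n
  have hc32 := hs.le_c
  set d : ℝ := (n : ℝ) ^ (-δ) with hd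
  have hd0 : 0 < d := by positivity
  set R := isolationRadius n δ with hR
  have hR0 : 0 < R := lt_of_lt_of_le (by positivity) hs.radius_lower
  set t : ℝ := 2 * (n : ℝ) ^ (-β) with ht
  have ht0 : 0 < t := by positivity
  rw [Real.rpow_one] at hc1
  rw [Real.rpow_zero] at e1 e2 e3 e4 e8
  rw [div_mul_eq_mul_div, div_le_one hε0] at e1 e2
  have hst : 2 * d ≤ t := by
    have : d ≤ (n : ℝ) ^ (-β) := Real.rpow_le_rpow_of_exponent_le (by linarith) (by linarith)
    linarith
  have hQ : 0 < (n : ℝ) ^ a := by positivity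
  -- the exceptional events
  set E0 : Set Ω := {ω | ¬ ∀ i : Fin n, ‖X i ω‖ ≤ 1} with hE0
  set E1 : Set Ω := {ω | ∃ q ∈ latticeIndices (n ^ 4), 1 - ε / 2 ≤ ‖latticePoint (n ^ 4) q‖ ∧
    n / c n < ‖∑ i : Fin n, cutoffInv (R / 2) (latticePoint (n ^ 4) q - X i ω) -
      n * ∫ u, cutoffInv (R / 2) (latticePoint (n ^ 4) q - u) ∂μ‖} with hE1
  set E2 : Set Ω := {ω | ENNReal.ofReal ((n : ℝ) ^ a) ≤ ∑ i : Fin n,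
    ∑ j ∈ Finset.univ.erase i, edgePairEnergy (2 * d) t p (X i ω, X j ω)} with hE2
  set E3 : Set Ω := {ω | ((Finset.univ.filter fun i : Fin n => 1 - d / 2 ≤ ‖X i ω‖).card : ℝ) <
    k / 2 * (n * (d / 2) ^ (α + 1))} with hE3
  have hcount : (n : ℝ) * (d / 2) ^ (α + 1) = (1 / 2) ^ (α + 1) * (n : ℝ) ^ γ := by
    rw [div_eq_mul_one_div, Real.mul_rpow hd0.le (by norm_num), hd, ← Real.rpow_mul hn.le, hγ,
      sub_eq_add_neg, Real.rpow_add hn, Real.rpow_one]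
    ring_nf
  have p0 : P.real E0 = 0 := by
    have : ∀ᵐ ω ∂P, ∀ i : Fin n, ‖X i ω‖ ≤ 1 := by
      rw [ae_all_iff]
      intro i
      have h1 := hE.supported
      rw [← hXlaw i] at h1
      exact ae_of_ae_map (hXmeas i).aemeasurable h1
    rw [measureReal_def, ae_iff.1 this, ENNReal.toReal_zero]
  have p1 : P.real E1 ≤ (c n)⁻¹ := by
    refine (hlattice n (n ^ 4) (R / 2) (c n) (by positivity) (by linarith)).trans ?_
    -- Here `n R = n^((1-δ)/6)` and `c_n^2 ≤ n^((1-δ)/24)`; the remaining gap absorbs `2 L₂`. The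
    -- resulting stretched exponential beats the at most `9 n^8` lattice points.
    have h1 : (n : ℝ) ^ ((1 - δ) / 12) ≤ n * (R / 2) / (L₂ * c n ^ 2) := by
      rw [le_div_iff₀ (by positivity)]
      have h2 : (n : ℝ) * R = (n : ℝ) ^ ((1 - δ) / 6) := by
        rw [hR, isolationRadius]
        conv_lhs => rw [← Real.rpow_one (n : ℝ)]
        rw [Real.rpow_one, ← Real.rpow_one_add' hn.le (by linarith)]
        congr 1
        ring
      have h3 : c n ^ 2 ≤ (n : ℝ) ^ ((1 - δ) / 24) := by
        calc c n ^ 2 ≤ ((n : ℝ) ^ ((1 - δ) / 48)) ^ 2 := by gcongr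
          _ = _ := by
            rw [← Real.rpow_natCast, ← Real.rpow_mul hn.le]
            congr 1
            push_cast
            ring
      rw [Real.rpow_add hn] at e6
      have h4 : (n : ℝ) ^ ((1 - δ) / 12) * (L₂ * c n ^ 2) ≤
          (n : ℝ) ^ ((1 - δ) / 12) * (L₂ * (n : ℝ) ^ ((1 - δ) / 24)) := by gcongr
      linarith
    have h5 : Real.exp (-(n * (R / 2) / (L₂ * c n ^ 2))) ≤ (n : ℝ) ^ (-10 : ℝ) :=
      (Real.exp_le_exp.2 (neg_le_neg h1)).trans e7
    have h6 : (2 * ((n ^ 4 : ℕ) : ℝ) + 1) ^ 2 ≤ 9 * (n : ℝ) ^ 8 := by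
      push_cast
      have : (1 : ℝ) ≤ (n : ℝ) ^ 4 := one_le_pow₀ (by linarith)
      calc (2 * (n : ℝ) ^ 4 + 1) ^ 2 ≤ (3 * (n : ℝ) ^ 4) ^ 2 := by gcongr; linarith
        _ = _ := by ring
    have h7 : (n : ℝ) ^ 8 * (n : ℝ) ^ (-10 : ℝ) = (n : ℝ) ^ (-2 : ℝ) := by
      rw [← Real.rpow_natCast, ← Real.rpow_add hn]
      norm_num
    calc _ ≤ 9 * (n : ℝ) ^ 8 * (4 * (n : ℝ) ^ (-10 : ℝ)) := by gcongr
      _ = 36 * (n : ℝ) ^ (-2 : ℝ) := by rw [← h7]; ring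
      _ ≤ (c n)⁻¹ := by
        rw [← one_div, le_div_iff₀ hcn]
        linarith
  have p2 : P.real E2 ≤ (c n)⁻¹ := by
    refine (hpairs n (2 * d) t ((n : ℝ) ^ a) (by positivity) hst (by rw [ht]; linarith)
      hQ).trans ?_
    have h1 : (n : ℝ) ^ 2 * (A * (2 * d) ^ (α + 1) * t ^ α) =
        A * 2 ^ (α + 1) * 2 ^ α * (n : ℝ) ^ (2 - δ * (α + 1) - β * α) := by
      rw [Real.mul_rpow (by norm_num) hd0.le, ht, Real.mul_rpow (by norm_num) (by positivity), hd,
        ← Real.rpow_mul hn.le, ← Real.rpow_mul hn.le, sub_eq_add_neg, sub_eq_add_neg,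
        Real.rpow_add hn, Real.rpow_add hn, Real.rpow_two]
      ring_nf
    rw [h1, ← one_div, div_le_div_iff₀ hQ hcn]
    linarith
  have p3 : P.real E3 ≤ (c n)⁻¹ := by
    refine (hE.measure_card_lt_le hXmeas hXindep hXlaw n (t := d / 2) (by positivity)
      (by linarith)).trans ?_
    have h1 : k / 16 * (n * (d / 2) ^ (α + 1)) = k' * (n : ℝ) ^ γ := by
      rw [hcount, hk']; ring
    rw [h1]
    have h2 : (n : ℝ) ^ (γ / 2) ≤ k' * (n : ℝ) ^ γ := by
      rw [one_div, ← div_eq_inv_mul, div_le_iff₀ hk'0] at e9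
      linarith
    calc _ ≤ Real.exp (-(n : ℝ) ^ (γ / 2)) := Real.exp_le_exp.2 (neg_le_neg h2)
      _ ≤ (n : ℝ)⁻¹ := by rw [← Real.rpow_neg_one]; exact e10
      _ ≤ _ := inv_anti₀ hcn hc1
  have hsub : {ω | ¬ (EnoughCriticalPoints (fun i : Fin n => X i ω) δ
            ((n : ℝ) ^ γ / (c n * Real.log n)) ∧
          RootsToCriticalPoints (fun i : Fin n => X i ω) δ (c n) 10 ∧
          CriticalPointsToRoots (fun i : Fin n => X i ω) δ (c n) 10 (20 / c n))} ⊆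
      (E0 ∪ E1) ∪ (E2 ∪ E3) := by
    intro ω hω
    by_contra hno
    simp only [Set.mem_union, not_or] at hno
    obtain ⟨⟨g0, g1⟩, g2, g3⟩ := hno
    simp only [hE0, hE1, hE2, hE3, Set.mem_ofPred_eq, not_not, not_exists, not_and, not_lt,
      not_le] at g0 g1 g2 g3
    refine hω ?_
    have hrlow := hs.radius_lower
    have hn4 : 8 * (n : ℝ) ≤ (n : ℝ) ^ 4 := by
      have : (2 : ℝ) ^ 3 ≤ (n : ℝ) ^ 3 := by gcongr
      calc 8 * (n : ℝ) = 2 ^ 3 * n := by norm_num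
        _ ≤ (n : ℝ) ^ 3 * n := by gcongr
        _ = (n : ℝ) ^ 4 := by ring
    have hm4 : 2 / ((n ^ 4 : ℕ) : ℝ) ≤ 1 / n := by
      push_cast
      rw [div_le_div_iff₀ (by positivity) hn]
      linarith only [hn4, hn]
    have hSb : ((n : ℝ) ^ a) ^ (2 / p) + n * (1 / t ^ 2) ≤ 2 * (n : ℝ) ^ σ := by
      have h1 : ((n : ℝ) ^ a) ^ (2 / p) = (n : ℝ) ^ b := by
        rw [← Real.rpow_mul hn.le, hp]
        congr 1
        field_simp
      have h2 : (n : ℝ) * (1 / t ^ 2) = 1 / 4 * (n : ℝ) ^ (1 + 2 * β) := by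
        rw [ht, Real.rpow_neg hn.le, Real.rpow_add hn, Real.rpow_one, mul_comm 2 β,
          Real.rpow_mul hn.le, Real.rpow_two]
        field_simp
        norm_num
      have h3 : (n : ℝ) ^ b ≤ (n : ℝ) ^ σ :=
        Real.rpow_le_rpow_of_exponent_le (by linarith) (le_max_left _ _)
      have h4 : (n : ℝ) ^ (1 + 2 * β) ≤ (n : ℝ) ^ σ :=
        Real.rpow_le_rpow_of_exponent_le (by linarith) (le_max_right _ _)
      have h5 : 0 < (n : ℝ) ^ σ := by positivity
      rw [h1, h2]
      linarith
    have hSR : 4 * R ^ 2 * (2 * (n : ℝ) ^ σ) ≤ 1 := by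
      have h1 : R ^ 2 * (n : ℝ) ^ σ = (n : ℝ) ^ (σ - (5 + δ) / 3) := by
        rw [hR, isolationRadius, ← Real.rpow_natCast, ← Real.rpow_mul hn.le, ← Real.rpow_add hn]
        congr 1
        push_cast
        ring
      linarith
    -- Fluctuation, mean error and the two discretisation errors are each at most `1/c_n`. The mesh
    -- `n^(-4)` suffices because `R ≥ 4/n`.
    have hτ : 1 / c n + L₁ * d ^ (1 / 4 : ℝ) + 2 * (2 / ((n ^ 4 : ℕ) : ℝ)) / R ^ 2 +
        4 * (2 / ((n ^ 4 : ℕ) : ℝ)) ≤ 4 / c n := by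
      have hinv : 1 / (n : ℝ) ≤ 1 / c n := one_div_le_one_div_of_le hcn hc1
      have h1 : L₁ * d ^ (1 / 4 : ℝ) ≤ 1 / c n := by
        rw [le_div_iff₀ hcn, hd, ← Real.rpow_mul hn.le, show -δ * (1 / 4) = -δ / 4 by ring]
        linarith
      have h2 : 2 * (2 / ((n ^ 4 : ℕ) : ℝ)) / R ^ 2 ≤ 1 / (n : ℝ) := by
        have h3 : (4 / (n : ℝ)) ^ 2 ≤ R ^ 2 := by gcongr
        calc 2 * (2 / ((n ^ 4 : ℕ) : ℝ)) / R ^ 2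
            ≤ 2 * (2 / ((n ^ 4 : ℕ) : ℝ)) / (4 / (n : ℝ)) ^ 2 := by gcongr
          _ = 1 / (n : ℝ) * (1 / (4 * n)) := by push_cast; field_simp; norm_num
          _ ≤ 1 / (n : ℝ) * 1 := by
            gcongr
            rw [div_le_one (by positivity)]
            linarith
          _ = 1 / (n : ℝ) := mul_one _
      have h4 : 4 * (2 / ((n ^ 4 : ℕ) : ℝ)) ≤ 1 / n := by
        push_cast
        rw [mul_div_assoc', div_le_div_iff₀ (by positivity) hn]
        linarith only [hn4]
      have h5 : 4 / c n = 1 / c n + 1 / c n + 1 / c n + 1 / c n := by ring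
      linarith
    have hW : WellSpread (fun i : Fin n => X i ω) δ (2 * (n : ℝ) ^ σ) (4 / c n) := by
      refine wellSpread_of_good (μ := μ) (ε := ε) (m := n ^ 4) (τ := L₁ * d ^ (1 / 4 : ℝ))
        (by have := hs.two_le; positivity) hp0 hp2.le hQ ht0 (by linarith) hE.eps_le hR0
        hs.radius_upper (hm4.trans ?_) hSb hSR hτ ?_ g0 g1 g2.le
      · have : 4 / (n : ℝ) / 4 = 1 / n := by ring
        rw [← this]
        gcongr
      · intro z hz
        exact hmean d hd0 e1 (R / 2) (by positivity) (by linarith [hs.radius_upper]) z hz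
    refine ⟨hW.enoughCriticalPoints hs (le_trans ?_ g3), hW.rootsToCriticalPoints hs,
      hW.criticalPointsToRoots hs⟩
    have hlog : 0 < Real.log n := Real.log_pos (by linarith)
    have h1 : k / 2 * (n * (d / 2) ^ (α + 1)) = 8 * k' * (n : ℝ) ^ γ := by
      rw [hcount, hk']; ring
    rw [h1, div_le_iff₀ (by positivity)]
    -- The count is of full order `n^γ`; since `c_n log n → ∞`, that factor absorbs the constant
    -- `8k'`.
    have h2 : 1 ≤ c n * Real.log n * (8 * k') := (div_le_iff₀ (by positivity)).1 e11
    calc (n : ℝ) ^ γ = 1 * (n : ℝ) ^ γ := (one_mul _).symm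
      _ ≤ c n * Real.log n * (8 * k') * (n : ℝ) ^ γ := by gcongr
      _ = _ := by ring
  rw [Real.norm_of_nonneg measureReal_nonneg, Real.norm_of_nonneg (by positivity)]
  calc _ ≤ P.real ((E0 ∪ E1) ∪ (E2 ∪ E3)) := measureReal_mono hsub (measure_ne_top _ _)
    _ ≤ (P.real E0 + P.real E1) + (P.real E2 + P.real E3) :=
        (measureReal_union_le _ _).trans
          (add_le_add (measureReal_union_le _ _) (measureReal_union_le _ _))
    _ ≤ _ := by linarith
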